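/- Let $\widehat f(\xi)=\int_{\mathbb R^2}e^{-ix\cdot\xi}f(x)\,dx$, let $|D|^s$ be the Fourier multiplier on $\mathbb R^2$ with symbol $|\xi|^s$, put $\|f\|_{\dot H^s}=\||D|^sf\|_{L^2(\mathbb R^2)}$, and let $S_+(t)=e^{-it|D|}$ be the multiplier with symbol $e^{-it|\xi|}$. For $M>1$ define the bilinear operator $(\cdot,\cdot)_{HH\to L}$, which isolates the high-high to low frequency interactions, by $$\big[(f,g)_{HH\to L}\big]\widehat{\ }(\xi)=\int_{\{\eta\in\mathbb R^2:\ |\xi|\le M^{-1}(|\eta|+|\xi-\eta|)\}}\widehat f(\eta)\,\widehat g(\xi-\eta)\,d\eta .$$ Theorem. Let $M>1$ and let $s_1,s_2,s_3\in\mathbb R$ satisfy $$s_1+s_2+s_3=\tfrac12,\qquad s_1,s_2<\tfrac58,\qquad s_1+s_2>0 .$$ Then there is a constant $C>0$, depending only on $M,s_1,s_2,s_3$, such that for all complex-valued Schwartz functions $f,g\in\mathcal S(\mathbb R^2)$ the free waves $u_+(t)=S_+(t)f$ and $v_+(t)=S_+(t)g$ satisfy $$\big\||D|^{-s_3}(u_+,v_+)_{HH\to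 L}\big\|_{L^2_{t,x}(\mathbb R\times\mathbb R^2)}\le C\,\|f\|_{\dot H^{s_1}}\|g\|_{\dot H^{s_2}},$$ where $\|f\|_{\dot H^{s_1}}$ and $\|g\|_{\dot H^{s_2}}$ are finite, $(u_+(t),v_+(t))_{HH\to L}$ and $|D|^{-s_3}(u_+(t),v_+(t))_{HH\to L}$ belong to $L^2(\mathbb R^2)$ for every $t\in\mathbb R$, and the left-hand side is finite. -/

import Mathlib

open MeasureTheory
open scoped FourierTransform SchwartzMap ENNReal

noncomputable section

/-- The Euclidean plane `ℝ²`. -/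
abbrev Plane : Type := EuclideanSpace ℝ (Fin 2)

/-- `L²(ℝ²; ℂ)`. -/
abbrev PlaneL2 : Type := Lp ℂ 2 (volume : Measure Plane)

/-- The element of `L²(ℝ²)` whose Fourier transform is `F`. It is meaningful when `F` is in `L²`;
the value is set to `0` otherwise. -/
def ofFourier (F : Plane → ℂ) : PlaneL2 :=
  open Classical in
  if h : MemLp F 2 (volume : Measure Plane) then 𝓕⁻ (h.toLp F : PlaneL2) else 0

/-- The Fourier transform of `φ(D) f`, where `D = ∇ / i`. Mathlib's `𝓕` has the kernel
`exp (-2πi x·ξ)`, so `D` has the symbol `2πξ` with respect to it. -/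
def multiplierFourier (φ : Plane → ℂ) (f : PlaneL2) (ξ : Plane) : ℂ :=
  φ ((2 * Real.pi) • ξ) * (𝓕 f : PlaneL2) ξ

/-- `f` belongs to the `L²`-domain of the Fourier multiplier `φ(D)`. -/
def InMultiplierDomain (φ : Plane → ℂ) (f : PlaneL2) : Prop :=
  MemLp (multiplierFourier φ f) 2 (volume : Measure Plane)

/-- The Fourier multiplier `φ(D) f`, for `f` in its domain. -/
def multiplier (φ : Plane → ℂ) (f : PlaneL2) : PlaneL2 :=
  ofFourier (multiplierFourier φ f)

/-- The symbol `|ξ|^s`. -/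
def absPowSymbol (s : ℝ) (ξ : Plane) : ℂ := ((‖ξ‖ ^ s : ℝ) : ℂ)

/-- `|D|^s f`. -/
def absD (s : ℝ) (f : PlaneL2) : PlaneL2 := multiplier (absPowSymbol s) f

/-- The homogeneous Sobolev norm `‖f‖_{Ḣ^s} = ‖ |D|^s f ‖_{L²}`. -/
def homSobolevNorm (s : ℝ) (f : PlaneL2) : ℝ := ‖absD s f‖

/-- The free propagator `S₊(t) = exp (-it|D|)`. -/
def propagatorPlus (t : ℝ) (f : PlaneL2) : PlaneL2 :=
  multiplier (fun ξ => Complex.exp (-(Complex.I * (t : ℂ) * (‖ξ‖ : ℂ)))) f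

/-- The Fourier transform of `(f, g)_{HH→L}`: the convolution of the two Fourier transforms,
restricted to the interactions with `|ξ| ≤ M⁻¹ (|η| + |ξ - η|)`. The factor `(2π)²` is the Jacobian
in passing from the kernel `exp (-i x·ξ)`, in which the operator has no factor, to
`exp (-2πi x·ξ)`; the set of interactions is invariant under scaling. -/
def highHighLowFourier (M : ℝ) (f g : PlaneL2) (ξ : Plane) : ℂ :=
  (2 * (Real.pi : ℂ)) ^ 2 *
    ∫ η : Plane, Set.indicator {η : Plane | ‖ξ‖ ≤ M⁻¹ * (‖η‖ + ‖ξ - η‖)}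
      (fun η => (𝓕 f : PlaneL2) η * (𝓕 g : PlaneL2) (ξ - η)) η

/-- `(f, g)` belongs to the `L²`-domain of the bilinear operator `(·,·)_{HH→L}`. -/
def InHighHighLowDomain (M : ℝ) (f g : PlaneL2) : Prop :=
  MemLp (highHighLowFourier M f g) 2 (volume : Measure Plane)

/-- The bilinear operator `(f, g)_{HH→L}`, for `(f, g)` in its domain. -/
def highHighLow (M : ℝ) (f g : PlaneL2) : PlaneL2 :=
  ofFourier (highHighLowFourier M f g)

/-- The function `t ↦ |D|^{-s} (u₊(t), v₊(t))_{HH→L}` for the free waves `u₊(t) = S₊(t) f` and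
`v₊(t) = S₊(t) g`. -/
def waveInteraction (M s : ℝ) (f g : PlaneL2) (t : ℝ) : PlaneL2 :=
  absD (-s) (highHighLow M (propagatorPlus t f) (propagatorPlus t g))

end

/-!
The proof works on the Fourier side, where it is a Schur test for the interaction of two free waves.
Write `a`, `b` for the Fourier transforms of `f`, `g`. At the output frequency `ξ`, the Fourier
transform of `(u₊(t), v₊(t))_{HH→L}` is an oscillatory integral in `η` with the phase
`t (‖η‖ + ‖ξ - η‖)` (`interaction`). Its mean square in `t`, regularized by a Gaussian, is bounded
by a quadratic form in `|a η b (ξ - η)|` whose kernel concentrates on pairs of points of the same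
ellipse with foci `0` and `ξ` (`lintegral_gaussian_mul_sq_le`).

For interactions with low output the ellipses are far from degenerate: along each ray from the
origin the phase has derivative at least `2 (1 - M⁻²)` (`hasDerivAt_phase_ray`). In polar
coordinates the kernel therefore integrates to a constant against `B η / ‖η‖` for any function `B`
of the direction of `η` with bounded circular mean. Cauchy–Schwarz with `B = 1` would be enough for
`s₃ ≤ 0`. For `0 < s₃ < 1/2` the singular factor `‖ξ‖^{-2 s₃}` must be compensated: when `ξ`
is small, the two incoming frequencies `η` and `ζ = ξ - η` are almost antipodal, and `‖ξ‖` is at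
least `‖η‖ |sin ∠(η, ζ)|` (`norm_mul_absSin_le`). The Schur weight is accordingly built
from the mean of `|b|²` against the angular weight `|sin ∠(η, ζ)|^{-κ}` with `κ = max (2 s₃) 0` (`angularMean`).
It has finite mass because `κ < 1`, which is the hypothesis `s₁ + s₂ > 0`, and after integration in `ξ` this same mean
appears again and cancels (`exists_lintegral_output_le`). Since the two incoming frequencies are
comparable, the remaining powers balance by scaling (`exists_weight_le`), and the resulting bound
does not depend on the regularization.

That all operators act within their domains follows from the decay of `a` and `b`, because the three
exponents are less than `1` in absolute value; the space-time function is measurable because it is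
continuous in `t` with values in `L²`.
-/

noncomputable section

/-! ### A Schur test -/

/-- Schur's test for a symmetric kernel, in the form of a bound for a quadratic form. The weight may
vanish or be infinite where `P` vanishes. -/
theorem lintegral_lintegral_mul_mul_le_of_schur {α : Type*} [MeasurableSpace α] {μ : Measure α}
    [SFinite μ] {P w : α → ℝ≥0∞} {K : α → α → ℝ≥0∞} {D : ℝ≥0∞}
    (hP : Measurable P) (hw : Measurable w) (hK : Measurable (Function.uncurry K))
    (hsymm : ∀ x y, K x y = K y x) (hD : ∀ x, ∫⁻ y, K x y * w y ∂μ ≤ D)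
    (hPw : ∀ᵐ x ∂μ, P x ≠ 0 → w x ≠ 0 ∧ w x ≠ ∞) :
    ∫⁻ x, ∫⁻ y, P x * P y * K x y ∂μ ∂μ ≤ 2 * D * ∫⁻ x, P x ^ 2 / w x ∂μ := by
  have hpt : ∀ x y, (P x ≠ 0 → w x ≠ 0 ∧ w x ≠ ∞) → (P y ≠ 0 → w y ≠ 0 ∧ w y ≠ ∞) →
      P x * P y * K x y ≤ P x ^ 2 / w x * (K x y * w y) + P y ^ 2 / w y * (K y x * w x) := by
    intro x y hx hy
    rcases eq_or_ne (P x) 0 with h0 | h0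
    · simp [h0]
    rcases eq_or_ne (P y) 0 with h1 | h1
    · simp [h1]
    obtain ⟨hx0, hxt⟩ := hx h0
    obtain ⟨hy0, hyt⟩ := hy h1
    have key : P x * P y ≤ P x ^ 2 / w x * w y + P y ^ 2 / w y * w x := by
      -- The product is at most one of the two terms, according to which of `P / w` is larger.
      rcases le_total (P x / w x) (P y / w y) with h | h
      · refine le_trans ?_ le_add_self
        calc P x * P y = (P x / w x * w x) * P y := by rw [ENNReal.div_mul_cancel hx0 hxt]
          _ ≤ (P y / w y * w x) * P y := by gcongr
          _ = P y ^ 2 / w y * w x := by simp only [div_eq_mul_inv]; ring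
      · refine le_trans ?_ le_self_add
        calc P x * P y = P x * (P y / w y * w y) := by rw [ENNReal.div_mul_cancel hy0 hyt]
          _ ≤ P x * (P x / w x * w y) := by gcongr
          _ = P x ^ 2 / w x * w y := by simp only [div_eq_mul_inv]; ring
    calc P x * P y * K x y ≤ (P x ^ 2 / w x * w y + P y ^ 2 / w y * w x) * K x y := by gcongr
      _ = _ := by rw [hsymm y x]; ring
  have hKl : Measurable fun p : α × α => K p.1 p.2 := hK
  have hm1 : Measurable fun p : α × α => P p.1 ^ 2 / w p.1 * (K p.1 p.2 * w p.2) := by fun_prop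
  have hm2 : Measurable fun p : α × α => P p.2 ^ 2 / w p.2 * (K p.2 p.1 * w p.1) :=
    hm1.comp measurable_swap
  have hone : ∫⁻ x, ∫⁻ y, P x ^ 2 / w x * (K x y * w y) ∂μ ∂μ ≤ D * ∫⁻ x, P x ^ 2 / w x ∂μ := by
    rw [← lintegral_const_mul _ (by fun_prop)]
    refine lintegral_mono fun x => ?_
    rw [lintegral_const_mul _ (by fun_prop), mul_comm]
    gcongr
    exact hD x
  calc ∫⁻ x, ∫⁻ y, P x * P y * K x y ∂μ ∂μ
      ≤ ∫⁻ x, ∫⁻ y, (P x ^ 2 / w x * (K x y * w y) + P y ^ 2 / w y * (K y x * w x)) ∂μ ∂μ := by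
        refine lintegral_mono_ae ?_
        filter_upwards [hPw] with x hx
        refine lintegral_mono_ae ?_
        filter_upwards [hPw] with y hy
        exact hpt x y hx hy
    _ = ∫⁻ x, ∫⁻ y, P x ^ 2 / w x * (K x y * w y) ∂μ ∂μ +
          ∫⁻ x, ∫⁻ y, P y ^ 2 / w y * (K y x * w x) ∂μ ∂μ := by
        rw [← lintegral_add_left hm1.lintegral_prod_right']
        refine lintegral_congr fun x => ?_
        rw [lintegral_add_left (by fun_prop)]
    _ = ∫⁻ x, ∫⁻ y, P x ^ 2 / w x * (K x y * w y) ∂μ ∂μ +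
          ∫⁻ x, ∫⁻ y, P x ^ 2 / w x * (K x y * w y) ∂μ ∂μ := by
        congr 1
        exact lintegral_lintegral_swap (f := fun x y => P y ^ 2 / w y * (K y x * w x))
          hm2.aemeasurable
    _ ≤ D * ∫⁻ x, P x ^ 2 / w x ∂μ + D * ∫⁻ x, P x ^ 2 / w x ∂μ := by gcongr
    _ = 2 * D * ∫⁻ x, P x ^ 2 / w x ∂μ := by ring

/-! ### Gaussian regularization of the time integral -/

/-- The Gaussian of mass one `τ ↦ ε^{-1/2} exp (-πτ²/ε)`, the Fourier transform of
`t ↦ exp (-πεt²)`. -/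
def gaussKernel (ε τ : ℝ) : ℝ := (√ε)⁻¹ * Real.exp (-(Real.pi / ε) * τ ^ 2)

theorem gaussKernel_pos {ε : ℝ} (hε : 0 < ε) (τ : ℝ) : 0 < gaussKernel ε τ := by
  unfold gaussKernel; positivity

theorem gaussKernel_neg (ε τ : ℝ) : gaussKernel ε (-τ) = gaussKernel ε τ := by
  simp [gaussKernel]

@[fun_prop]
theorem continuous_gaussKernel (ε : ℝ) : Continuous (gaussKernel ε) := by
  unfold gaussKernel; fun_prop

theorem lintegral_gaussKernel {ε : ℝ} (hε : 0 < ε) :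
    ∫⁻ τ, ENNReal.ofReal (gaussKernel ε τ) = 1 := by
  rw [← ofReal_integral_eq_lintegral_ofReal]
  · unfold gaussKernel
    rw [integral_const_mul, integral_gaussian, div_div_cancel₀ Real.pi_ne_zero,
      inv_mul_cancel₀ (by positivity), ENNReal.ofReal_one]
  · exact (integrable_exp_neg_mul_sq (by positivity)).const_mul _
  · exact .of_forall fun τ => (gaussKernel_pos hε τ).le

/-- The Fourier transform of a Gaussian, with the frequency as a real number. -/
theorem integral_gaussian_mul_oscillation {ε : ℝ} (hε : 0 < ε) (τ : ℝ) :
    ∫ t : ℝ, (Real.exp (-Real.pi * ε * t ^ 2) : ℂ) *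
      Complex.exp (-(2 * Real.pi * Complex.I * t * τ)) = gaussKernel ε τ := by
  have h := congrFun (fourier_gaussian_pi (b := (ε : ℂ)) (by simpa using hε)) τ
  rw [Real.fourier_eq'] at h
  have h1 : ((ε : ℂ)) ^ (1 / 2 : ℂ) = ((√ε : ℝ) : ℂ) := by
    rw [Real.sqrt_eq_rpow, Complex.ofReal_cpow hε.le]; norm_num
  rw [h1] at h
  rw [gaussKernel]
  push_cast
  convert h using 1
  · refine integral_congr_ae (.of_forall fun t => ?_)
    simp only [smul_eq_mul, RCLike.inner_apply, conj_trivial]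
    push_cast
    rw [mul_comm]
    congr 2
    · ring
  · rw [one_div]; congr 2; ring

/-- A quadratic form in the amplitude controls the mean square of an oscillatory integral. -/
theorem lintegral_gaussian_mul_sq_le {α : Type*} [MeasurableSpace α] {μ : Measure α} [SFinite μ]
    {F : α → ℂ} {φ : α → ℝ} (hF : Integrable F μ) (hφ : Measurable φ) {ε : ℝ} (hε : 0 < ε) :
    ∫⁻ t : ℝ, ENNReal.ofReal (Real.exp (-Real.pi * ε * t ^ 2)) *
        ‖∫ x, F x * Complex.exp (-(2 * Real.pi * Complex.I * t * φ x)) ∂μ‖ₑ ^ 2 ≤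
      ∫⁻ x, ∫⁻ y, ‖F x‖ₑ * ‖F y‖ₑ * ENNReal.ofReal (gaussKernel ε (φ x - φ y)) ∂μ ∂μ := by
  set T : ℝ → ℂ := fun t => ∫ x, F x * Complex.exp (-(2 * Real.pi * Complex.I * t * φ x)) ∂μ
    with hT
  set Φ : ℝ × (α × α) → ℂ := fun p => (Real.exp (-Real.pi * ε * p.1 ^ 2) : ℂ) *
    (F p.2.1 * starRingEnd ℂ (F p.2.2)) *
    Complex.exp (-(2 * Real.pi * Complex.I * p.1 * ((φ p.2.1 - φ p.2.2 : ℝ) : ℂ))) with hΦ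
  have hosc : ∀ (t s : ℝ), ‖Complex.exp (-(2 * Real.pi * Complex.I * t * s))‖ = 1 := by
    intro t s
    have : -(2 * Real.pi * Complex.I * t * s) = ((-(2 * Real.pi * t * s) : ℝ) : ℂ) * Complex.I := by
      push_cast; ring
    rw [this, Complex.norm_exp_ofReal_mul_I]
  have hFF : Integrable (fun z : α × α => F z.1 * starRingEnd ℂ (F z.2)) (μ.prod μ) := by
    refine Integrable.mul_prod hF (g := fun x => starRingEnd ℂ (F x)) ?_
    exact (RCLike.conjCLE (K := ℂ)).toContinuousLinearMap.integrable_comp hF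
  have hG : Integrable (fun t : ℝ => (Real.exp (-Real.pi * ε * t ^ 2) : ℂ)) := by
    refine Complex.ofRealCLM.integrable_comp (φ := fun t : ℝ => Real.exp (-Real.pi * ε * t ^ 2)) ?_
    simpa only [neg_mul] using integrable_exp_neg_mul_sq (b := Real.pi * ε) (by positivity)
  have hΦi : Integrable Φ (volume.prod (μ.prod μ)) := by
    refine (hG.mul_prod hFF).mul_bdd (c := 1) ?_ ?_
    · refine Measurable.aestronglyMeasurable ?_
      fun_prop
    · exact .of_forall fun p => (hosc _ _).le
  have hTT : ∀ t : ℝ, (Real.exp (-Real.pi * ε * t ^ 2) : ℂ) * (T t * starRingEnd ℂ (T t)) =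
      ∫ z, Φ (t, z) ∂(μ.prod μ) := by
    intro t
    rw [hT, ← integral_conj, ← integral_prod_mul, ← integral_const_mul]
    refine integral_congr_ae (.of_forall fun z => ?_)
    simp only [hΦ, map_mul, ← Complex.exp_conj]
    rw [mul_mul_mul_comm, ← Complex.exp_add, ← mul_assoc]
    congr 2
    simp [Complex.conj_ofNat]
    ring
  have hreal : ∀ t, (Real.exp (-Real.pi * ε * t ^ 2) : ℂ) * (T t * starRingEnd ℂ (T t)) =
      ((Real.exp (-Real.pi * ε * t ^ 2) * ‖T t‖ ^ 2 : ℝ) : ℂ) := by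
    intro t
    rw [Complex.mul_conj, Complex.normSq_eq_norm_sq]
    push_cast; ring
  have hint : Integrable fun t => Real.exp (-Real.pi * ε * t ^ 2) * ‖T t‖ ^ 2 := by
    have := hΦi.integral_prod_left
    simp_rw [← hTT, hreal] at this
    refine this.norm.congr (.of_forall fun t => ?_)
    simp only [Complex.norm_real]
    exact Real.norm_of_nonneg (by positivity)
  have hLHS : ∫⁻ t : ℝ, ENNReal.ofReal (Real.exp (-Real.pi * ε * t ^ 2)) * ‖T t‖ₑ ^ 2 =
      ENNReal.ofReal (∫ t, Real.exp (-Real.pi * ε * t ^ 2) * ‖T t‖ ^ 2) := by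
    rw [ofReal_integral_eq_lintegral_ofReal hint (.of_forall fun t => by positivity)]
    refine lintegral_congr fun t => ?_
    rw [ENNReal.ofReal_mul (by positivity), ENNReal.ofReal_pow (by positivity),
      ofReal_norm]
  have hval : ((∫ t, Real.exp (-Real.pi * ε * t ^ 2) * ‖T t‖ ^ 2 : ℝ) : ℂ) =
      ∫ z, F z.1 * starRingEnd ℂ (F z.2) * (gaussKernel ε (φ z.1 - φ z.2) : ℂ) ∂(μ.prod μ) := by
    rw [← integral_complex_ofReal]
    simp_rw [← hreal, hTT]
    rw [integral_integral_swap (f := fun t z => Φ (t, z)) hΦi]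
    refine integral_congr_ae (.of_forall fun z => ?_)
    simp only [hΦ]
    rw [← integral_gaussian_mul_oscillation hε, ← integral_const_mul]
    refine integral_congr_ae (.of_forall fun t => ?_)
    simp only
    ring
  have hFm : AEMeasurable (fun x => ‖F x‖ₑ) μ := hF.1.enorm
  calc ∫⁻ t : ℝ, ENNReal.ofReal (Real.exp (-Real.pi * ε * t ^ 2)) * ‖T t‖ₑ ^ 2
      = ENNReal.ofReal (∫ t, Real.exp (-Real.pi * ε * t ^ 2) * ‖T t‖ ^ 2) := hLHS
    _ ≤ ‖((∫ t, Real.exp (-Real.pi * ε * t ^ 2) * ‖T t‖ ^ 2 : ℝ) : ℂ)‖ₑ := by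
        rw [← ofReal_norm]
        refine ENNReal.ofReal_le_ofReal ?_
        rw [Complex.norm_real]
        exact le_abs_self _
    _ ≤ ∫⁻ z, ‖F z.1 * starRingEnd ℂ (F z.2) * (gaussKernel ε (φ z.1 - φ z.2) : ℂ)‖ₑ
          ∂(μ.prod μ) := by
        rw [hval]; exact enorm_integral_le_lintegral_enorm _
    _ = ∫⁻ z, ‖F z.1‖ₑ * ‖F z.2‖ₑ * ENNReal.ofReal (gaussKernel ε (φ z.1 - φ z.2))
          ∂(μ.prod μ) := by
        refine lintegral_congr fun z => ?_
        rw [enorm_mul, enorm_mul]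
        congr 1
        · congr 1
          rw [← ofReal_norm, RCLike.norm_conj, ofReal_norm]
        · rw [← ofReal_norm, Complex.norm_real, Real.norm_of_nonneg
            (gaussKernel_pos hε _).le]
    _ = _ := by
        rw [lintegral_prod]
        refine AEMeasurable.mul (hFm.comp_fst.mul hFm.comp_snd) ?_
        exact Measurable.aemeasurable (by fun_prop)

/-! ### The phase along a ray -/

/-- Along the ray of direction `v`, the phase `r ↦ r + ‖ξ - r v‖` has derivative `1 + cos α`, where
`α` is the angle between `v` and `r v - ξ`. The interaction condition keeps `α` away from `π`,
because `(r + ‖ξ - r v‖)² - ‖ξ‖² = 2 r ‖ξ - r v‖ (1 + cos α)`. -/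
theorem hasDerivAt_phase_ray {E : Type*} [NormedAddCommGroup E] [InnerProductSpace ℝ E]
    {m : ℝ} (hm0 : 0 ≤ m) (hm : m < 1) {v ξ : E} (hv : ‖v‖ = 1) {r : ℝ} (hr : 0 < r)
    (hA : ‖ξ‖ ≤ m * (r + ‖ξ - r • v‖)) :
    ∃ d, HasDerivAt (fun r : ℝ => r + ‖ξ - r • v‖) d r ∧ 2 * (1 - m ^ 2) ≤ d := by
  set p := inner ℝ ξ v with hp
  have hsq : ∀ r : ℝ, ‖ξ - r • v‖ ^ 2 = ‖ξ‖ ^ 2 - 2 * r * p + r ^ 2 := by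
    intro r
    rw [norm_sub_sq_real, inner_smul_right, norm_smul, hv, Real.norm_eq_abs, mul_one, sq_abs]
    ring
  set q := ‖ξ - r • v‖ with hq
  have hq0 : 0 < q := by
    rcases (norm_nonneg (ξ - r • v)).eq_or_lt with h | h
    · exfalso
      have h0 : ξ = r • v := by
        rw [← sub_eq_zero, ← norm_eq_zero]; exact h.symm
      rw [hq, ← h, h0, norm_smul, hv, Real.norm_of_nonneg hr.le] at hA
      nlinarith
    · exact h
  refine ⟨1 + (r - p) / q, ?_, ?_⟩
  · have hfun : (fun r : ℝ => r + ‖ξ - r • v‖) =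
        fun r => r + √(‖ξ‖ ^ 2 - 2 * r * p + r ^ 2) := by
      ext r; rw [← hsq, Real.sqrt_sq (norm_nonneg _)]
    rw [hfun]
    have h1 : HasDerivAt (fun r : ℝ => ‖ξ‖ ^ 2 - 2 * r * p + r ^ 2) (2 * (r - p)) r := by
      have := ((((hasDerivAt_id r).const_mul 2).mul_const p).const_sub (‖ξ‖ ^ 2)).add
        (hasDerivAt_pow 2 r)
      refine this.congr_deriv ?_
      push_cast; ring
    have h2 := (hasDerivAt_id r).add (h1.sqrt (by rw [← hsq]; positivity))
    refine h2.congr_deriv ?_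
    rw [← hsq, Real.sqrt_sq (norm_nonneg _), ← hq]
    field_simp
  · have h1 := hsq r
    rw [← hq] at h1
    have h2 : ‖ξ‖ ^ 2 ≤ m ^ 2 * (r + q) ^ 2 := by
      rw [← mul_pow]; gcongr
    have h3 : (1 - m ^ 2) * (4 * (r * q)) ≤ 2 * r * (r + q - p) := by
      have : (1 - m ^ 2) * (4 * (r * q)) ≤ (1 - m ^ 2) * (r + q) ^ 2 := by
        have : 0 ≤ 1 - m ^ 2 := by nlinarith
        gcongr
        nlinarith [sq_nonneg (r - q)]
      nlinarith
    have h4 : 2 * (1 - m ^ 2) * q ≤ r + q - p := by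
      by_contra! hlt
      nlinarith [mul_lt_mul_of_pos_left hlt (show 0 < 2 * r by positivity)]
    rw [← sub_le_iff_le_add', le_div_iff₀ hq0]
    linarith

/-- A ray meets an ellipse with foci `0` and `ξ` only once. -/
theorem injOn_phase_ray {E : Type*} [NormedAddCommGroup E] [InnerProductSpace ℝ E]
    {m : ℝ} (hm : m < 1) {v ξ : E} (hv : ‖v‖ = 1) :
    Set.InjOn (fun r : ℝ => r + ‖ξ - r • v‖)
      {r | 0 < r ∧ ‖ξ‖ ≤ m * (r + ‖ξ - r • v‖)} := by
  set p := inner ℝ ξ v with hp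
  have hpn : p ≤ ‖ξ‖ := by simpa [hv] using real_inner_le_norm ξ v
  have hform : ∀ r : ℝ, ‖ξ‖ ^ 2 - (r + ‖ξ - r • v‖) ^ 2 = 2 * r * (p - (r + ‖ξ - r • v‖)) := by
    intro r
    have hsq : ‖ξ - r • v‖ ^ 2 = ‖ξ‖ ^ 2 - 2 * r * p + r ^ 2 := by
      rw [norm_sub_sq_real, inner_smul_right, norm_smul, hv, Real.norm_eq_abs, mul_one, sq_abs]
      ring
    nlinarith
  rintro r ⟨hr, hrA⟩ r' ⟨_, _⟩ heq
  have h1 := hform r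
  have h2 := hform r'
  simp only at heq
  rw [← heq] at h2
  -- The phase exceeds `‖ξ‖ ≥ p`, so the linear equation `hform` determines `r` from the phase.
  have hlt : p - (r + ‖ξ - r • v‖) < 0 := by
    have := norm_nonneg (ξ - r • v)
    nlinarith
  have := h1.symm.trans h2
  have h3 := mul_right_cancel₀ hlt.ne this
  linarith

/-- The change of variables `τ = r + ‖ξ - r v‖` along a ray. -/
theorem setLIntegral_phase_ray_le {E : Type*} [NormedAddCommGroup E] [InnerProductSpace ℝ E]
    {m : ℝ} (hm0 : 0 ≤ m) (hm : m < 1) {v : E} (hv : ‖v‖ = 1) (ξ : E) (k : ℝ → ℝ≥0∞) :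
    ∫⁻ r in {r : ℝ | 0 < r ∧ ‖ξ‖ ≤ m * (r + ‖ξ - r • v‖)}, k (r + ‖ξ - r • v‖) ≤
      (ENNReal.ofReal (2 * (1 - m ^ 2)))⁻¹ * ∫⁻ τ, k τ := by
  set S := {r : ℝ | 0 < r ∧ ‖ξ‖ ≤ m * (r + ‖ξ - r • v‖)} with hS
  have hSm : MeasurableSet S :=
    (measurableSet_lt measurable_const measurable_id).inter
      (measurableSet_le measurable_const
      (by fun_prop : Continuous fun r : ℝ => m * (r + ‖ξ - r • v‖)).measurable)
  set c := 2 * (1 - m ^ 2) with hc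
  have hc0 : 0 < c := by nlinarith
  have hd : ∀ r ∈ S, HasDerivWithinAt (fun r : ℝ => r + ‖ξ - r • v‖)
      (deriv (fun r : ℝ => r + ‖ξ - r • v‖) r) S r ∧
      c ≤ deriv (fun r : ℝ => r + ‖ξ - r • v‖) r := by
    rintro r ⟨hr, hrA⟩
    obtain ⟨d, hd, hcd⟩ := hasDerivAt_phase_ray hm0 hm hv hr hrA
    rw [hd.deriv]
    exact ⟨hd.hasDerivWithinAt, hcd⟩
  have hcne : ENNReal.ofReal c ≠ 0 := by simpa using hc0
  rw [mul_comm, ← div_eq_mul_inv, ENNReal.le_div_iff_mul_le (.inl hcne)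
    (.inl ENNReal.ofReal_ne_top), mul_comm, ← lintegral_const_mul' _ _ ENNReal.ofReal_ne_top]
  calc ∫⁻ r in S, ENNReal.ofReal c * k (r + ‖ξ - r • v‖)
      ≤ ∫⁻ r in S, ENNReal.ofReal |deriv (fun r : ℝ => r + ‖ξ - r • v‖) r| *
          k (r + ‖ξ - r • v‖) := by
        refine setLIntegral_mono' hSm fun r hr => ?_
        gcongr
        exact (hd r hr).2.trans (le_abs_self _)
    _ = ∫⁻ τ in (fun r : ℝ => r + ‖ξ - r • v‖) '' S, k τ :=
        (lintegral_image_eq_lintegral_abs_deriv_mul hSm (fun r hr => (hd r hr).1)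
          (injOn_phase_ray hm hv) k).symm
    _ ≤ ∫⁻ τ, k τ := setLIntegral_le_lintegral _ _

/-! ### The angular weight -/

/-- The area form of the plane. -/
def wedge (η ζ : Plane) : ℝ := η 0 * ζ 1 - η 1 * ζ 0

/-- The absolute value of the sine of the angle between the lines spanned by `η` and `ζ`; it is `0`
if one of the vectors vanishes. -/
def absSin (η ζ : Plane) : ℝ := |wedge η ζ| / (‖η‖ * ‖ζ‖)

/-- The weight `|sin ∠(η, ζ)|^{-κ}`, with the value `∞` for parallel `η` and `ζ` when `κ > 0`. -/
def angularWeight (κ : ℝ) (η ζ : Plane) : ℝ≥0∞ := ENNReal.ofReal (absSin η ζ) ^ (-κ)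

@[fun_prop]
theorem continuous_wedge : Continuous fun p : Plane × Plane => wedge p.1 p.2 := by
  unfold wedge; fun_prop

theorem measurable_angularWeight (κ : ℝ) :
    Measurable (Function.uncurry (angularWeight κ)) := by
  change Measurable fun p : Plane × Plane =>
    ENNReal.ofReal (|wedge p.1 p.2| / (‖p.1‖ * ‖p.2‖)) ^ (-κ)
  refine Measurable.pow_const (Measurable.ennreal_ofReal (Measurable.div ?_ ?_)) _
  · exact continuous_wedge.abs.measurable
  · fun_prop

theorem abs_wedge_le (η ζ : Plane) : |wedge η ζ| ≤ ‖η‖ * ‖ζ‖ := by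
  rw [EuclideanSpace.norm_eq, EuclideanSpace.norm_eq, ← Real.sqrt_mul (by positivity)]
  refine Real.abs_le_sqrt ?_
  simp only [wedge, Fin.sum_univ_two, Real.norm_eq_abs, sq_abs]
  nlinarith [sq_nonneg (η 0 * ζ 0 + η 1 * ζ 1)]

/-- The distance from `η` to the line spanned by `ζ` is at most `‖η + ζ‖`. -/
theorem norm_mul_absSin_le (η ζ : Plane) : ‖η‖ * absSin η ζ ≤ ‖η + ζ‖ := by
  rcases eq_or_ne η 0 with rfl | hη
  · simp
  rcases eq_or_ne ζ 0 with rfl | hζ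
  · simp [absSin]
  have hζ' : 0 < ‖ζ‖ := norm_pos_iff.2 hζ
  have hη' : 0 < ‖η‖ := norm_pos_iff.2 hη
  have h : wedge (η + ζ) ζ = wedge η ζ := by simp [wedge]; ring
  have := abs_wedge_le (η + ζ) ζ
  rw [h] at this
  rw [absSin, ← mul_div_assoc, mul_comm ‖η‖ ‖ζ‖, mul_comm ‖η‖, mul_div_mul_right _ _ hη'.ne']
  exact (div_le_iff₀ hζ').2 this

theorem angularWeight_ne_zero (κ : ℝ) (η ζ : Plane) (hκ : 0 ≤ κ) : angularWeight κ η ζ ≠ 0 := by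
  rw [angularWeight, Ne, ENNReal.rpow_eq_zero_iff]
  rintro (⟨_, h⟩ | ⟨h, _⟩)
  · linarith
  · exact ENNReal.ofReal_ne_top h

/-- The circular integral of the angular weight with exponent `κ`. -/
def angularMass (κ : ℝ) : ℝ≥0∞ :=
  ∫⁻ θ in Set.Ioo (-Real.pi) Real.pi, ENNReal.ofReal |Real.sin θ| ^ (-κ)

theorem angularMass_ne_top {κ : ℝ} (hκ0 : 0 ≤ κ) (hκ : κ < 1) : angularMass κ ≠ ∞ := by
  set g : ℝ → ℝ := fun θ => |Real.sin θ| ^ (-κ) with hg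
  have hgm : Measurable g := by fun_prop
  -- Jordan's inequality near `0`; the rest of the circle follows by reflection.
  have h1 : IntervalIntegrable g volume 0 (Real.pi / 2) := by
    have h0 : IntervalIntegrable (fun θ : ℝ => (2 / Real.pi) ^ (-κ) * θ ^ (-κ)) volume 0
        (Real.pi / 2) :=
      (intervalIntegral.intervalIntegrable_rpow' (by linarith)).const_mul _
    refine h0.mono_fun' hgm.aestronglyMeasurable ?_
    rw [Set.uIoc_of_le (by positivity)]
    refine (ae_restrict_iff' measurableSet_Ioc).2 (.of_forall fun θ hθ => ?_)
    have hs := Real.mul_le_sin hθ.1.le hθ.2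
    have hθ0 := hθ.1
    have hpos : 0 < 2 / Real.pi * θ := by positivity
    simp only [hg]
    rw [Real.norm_of_nonneg (by positivity), ← Real.mul_rpow (by positivity) hθ0.le,
      abs_of_pos (hpos.trans_le hs)]
    exact Real.rpow_le_rpow_of_nonpos hpos hs (by linarith)
  have h2 : IntervalIntegrable g volume 0 Real.pi := by
    refine h1.trans ?_
    have := (h1.comp_sub_left Real.pi).symm
    simpa [hg, Real.sin_pi_sub, sub_half] using this
  have h3 : IntervalIntegrable g volume (-Real.pi) Real.pi := by
    refine IntervalIntegrable.trans ?_ h2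
    have := (h2.comp_sub_left 0).symm
    simpa [hg] using this
  have h4 : IntegrableOn g (Set.Ioo (-Real.pi) Real.pi) :=
    ((intervalIntegrable_iff_integrableOn_Ioo_of_le (by linarith [Real.pi_pos])).1 h3)
  have h5 : angularMass κ = ∫⁻ θ in Set.Ioo (-Real.pi) Real.pi, ENNReal.ofReal (g θ) := by
    refine lintegral_congr_ae ((ae_restrict_iff' measurableSet_Ioo).2 ?_)
    filter_upwards [Measure.ae_ne volume (0 : ℝ)] with θ hθ0 hθ
    have : Real.sin θ ≠ 0 := by
      rcases hθ0.lt_or_gt with h | h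
      · exact (Real.sin_neg_of_neg_of_neg_pi_lt h hθ.1).ne
      · exact (Real.sin_pos_of_pos_of_lt_pi h hθ.2).ne'
    rw [ENNReal.ofReal_rpow_of_pos (by positivity)]
  rw [h5]
  exact h4.lintegral_lt_top.ne

/-- The identification of `ℂ` with the plane that takes the direction of the positive real axis to
the direction of `ζ`. -/
theorem exists_isometry_to_direction {ζ : Plane} (hζ : ζ ≠ 0) :
    ∃ L : ℂ ≃ₗᵢ[ℝ] Plane, ∀ z : ℂ, absSin (L z) ζ = |z.im| / ‖z‖ := by
  set B := Complex.orthonormalBasisOneI.repr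
  set a : ℂ := B.symm ζ with ha
  have ha0 : a ≠ 0 := by simpa [ha] using hζ
  have hna : ‖a‖ = ‖ζ‖ := B.symm.norm_map ζ
  have hBa : ζ = B a := by simp [ha]
  have hn0 : ‖a‖ ≠ 0 := norm_ne_zero_iff.2 ha0
  set u : Circle := ⟨a / ‖a‖, by simp [Submonoid.unitSphere, hn0]⟩ with hu
  refine ⟨(rotation u).trans B, fun z => ?_⟩
  have hw : wedge ((rotation u).trans B z) ζ = -(‖a‖ * z.im) := by
    rw [hBa]
    have h1 : ∀ w : ℂ, B w = !₂[w.re, w.im] := by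
      intro w; ext i; fin_cases i <;> simp [B]
    have h2 : ((rotation u).trans B) z = B (a / ‖a‖ * z) := by
      change B (rotation u z) = _
      rw [rotation_apply]
    have h3 : a.re ^ 2 + a.im ^ 2 = ‖a‖ ^ 2 := by
      rw [← Complex.normSq_eq_norm_sq, Complex.normSq_apply]; ring
    have h4 : (a / (‖a‖ : ℂ)).re = a.re / ‖a‖ := by simp
    have h5 : (a / (‖a‖ : ℂ)).im = a.im / ‖a‖ := by simp
    rw [h2, h1, h1, wedge]
    simp only [Complex.mul_re, Complex.mul_im, h4, h5, Matrix.cons_val_zero,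
      Matrix.cons_val_one]
    field_simp
    linear_combination (-z.im) * h3
  have hnz : ‖(rotation u).trans B z‖ = ‖z‖ := LinearIsometryEquiv.norm_map _ z
  rw [absSin, hw, hnz, ← hna, abs_neg, abs_mul, abs_norm, mul_comm ‖z‖,
    mul_div_mul_left _ _ hn0]

/-! ### The Schur bound for the interaction kernel -/

/-- The interactions `(η, ξ - η)` of two frequencies with sum `ξ` that are high compared with
`ξ`. -/
def highHighSet (m : ℝ) (ξ : Plane) : Set Plane := {η | ‖ξ‖ ≤ m * (‖η‖ + ‖ξ - η‖)}

theorem measurableSet_highHighSet_prod (m : ℝ) :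
    MeasurableSet {p : Plane × Plane | p.2 ∈ highHighSet m p.1} := by
  have h : Measurable fun p : Plane × Plane => m * (‖p.2‖ + ‖p.1 - p.2‖) := by fun_prop
  exact measurableSet_le measurable_fst.norm h

theorem measurableSet_highHighSet (m : ℝ) (ξ : Plane) : MeasurableSet (highHighSet m ξ) := by
  have h : Measurable fun η : Plane => m * (‖η‖ + ‖ξ - η‖) := by fun_prop
  exact measurableSet_le measurable_const h

/-- The integral of a function of the phase `‖η‖ + ‖ξ - η‖` over the interactions, with an angular
weight, in polar coordinates. -/
theorem lintegral_phase_angularWeight_le {m : ℝ} (hm0 : 0 ≤ m) (hm : m < 1) (κ : ℝ) (ξ : Plane)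
    {ζ : Plane} (hζ : ζ ≠ 0) {k : ℝ → ℝ≥0∞} (hk : Measurable k) :
    ∫⁻ η, (highHighSet m ξ).indicator (fun η => k (‖η‖ + ‖ξ - η‖)) η *
        (angularWeight κ η ζ / ENNReal.ofReal ‖η‖) ≤
      angularMass κ * ((ENNReal.ofReal (2 * (1 - m ^ 2)))⁻¹ * ∫⁻ τ, k τ) := by
  obtain ⟨L, hL⟩ := exists_isometry_to_direction hζ
  set G : Plane → ℝ≥0∞ := fun η => (highHighSet m ξ).indicator (fun η => k (‖η‖ + ‖ξ - η‖)) η *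
    (angularWeight κ η ζ / ENNReal.ofReal ‖η‖) with hG
  set v : ℝ → Plane := fun θ => L (Real.cos θ + Real.sin θ * Complex.I) with hvdef
  have hvn : ∀ θ, ‖v θ‖ = 1 := by
    intro θ
    rw [hvdef, LinearIsometryEquiv.norm_map, Complex.ofReal_cos, Complex.ofReal_sin,
      ← Complex.exp_mul_I, Complex.norm_exp_ofReal_mul_I]
  set S : ℝ → Set ℝ := fun θ => {r : ℝ | 0 < r ∧ ‖ξ‖ ≤ m * (r + ‖ξ - r • v θ‖)} with hS
  have hSm : ∀ θ, MeasurableSet (S θ) := fun θ =>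
    (measurableSet_lt measurable_const measurable_id).inter (measurableSet_le measurable_const
      (by fun_prop : Continuous fun r : ℝ => m * (r + ‖ξ - r • v θ‖)).measurable)
  have hGm : Measurable G := by
    have h1 : Measurable fun η : Plane => ‖η‖ + ‖ξ - η‖ := by fun_prop
    have h2 : Measurable fun η : Plane => angularWeight κ η ζ :=
      (measurable_angularWeight κ).of_uncurry_right
    exact ((hk.comp h1).indicator (measurableSet_highHighSet m ξ)).mul
      (h2.div measurable_norm.ennreal_ofReal)
  have hpol : ∀ r θ : ℝ, 0 < r → ENNReal.ofReal r * G (L (Complex.polarCoord.symm (r, θ))) =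
      ENNReal.ofReal |Real.sin θ| ^ (-κ) *
        (S θ).indicator (fun r => k (r + ‖ξ - r • v θ‖)) r := by
    intro r θ hr
    have h1 : L (Complex.polarCoord.symm (r, θ)) = r • v θ := by
      have : Complex.polarCoord.symm (r, θ) = r • (Real.cos θ + Real.sin θ * Complex.I : ℂ) := by
        rw [Complex.polarCoord_symm_apply, Complex.real_smul]
      rw [this]
      exact L.map_smul r _
    have h2 : absSin (L (Complex.polarCoord.symm (r, θ))) ζ = |Real.sin θ| := by
      rw [hL, Complex.norm_polarCoord_symm, Complex.polarCoord_symm_apply]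
      simp [-Complex.ofReal_sin, -Complex.ofReal_cos, abs_mul, hr.ne']
    have h3 : ‖r • v θ‖ = r := by rw [norm_smul, hvn, mul_one, Real.norm_of_nonneg hr.le]
    have h4 : (highHighSet m ξ).indicator (fun η => k (‖η‖ + ‖ξ - η‖)) (r • v θ) =
        (S θ).indicator (fun r => k (r + ‖ξ - r • v θ‖)) r := by
      simp only [Set.indicator_apply, highHighSet, hS, Set.mem_ofPred_eq, h3, hr, true_and]
    have hr0 : ENNReal.ofReal r ≠ 0 := by simpa using hr
    simp only [hG, angularWeight, h2]
    rw [h1, h4, h3, div_eq_mul_inv]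
    calc _ = (ENNReal.ofReal r * (ENNReal.ofReal r)⁻¹) * (ENNReal.ofReal |Real.sin θ| ^ (-κ) *
        (S θ).indicator (fun r => k (r + ‖ξ - r • v θ‖)) r) := by ring
      _ = _ := by rw [ENNReal.mul_inv_cancel hr0 ENNReal.ofReal_ne_top, one_mul]
  have hm' : Measurable fun p : ℝ × ℝ => ENNReal.ofReal p.1 *
      G (L (Complex.polarCoord.symm p)) := by
    refine Measurable.mul (by fun_prop) (hGm.comp (L.continuous.measurable.comp ?_))
    have : (⇑Complex.polarCoord.symm : ℝ × ℝ → ℂ) =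
        fun p => (p.1 : ℂ) * (Real.cos p.2 + Real.sin p.2 * Complex.I) :=
      funext Complex.polarCoord_symm_apply
    rw [this]
    fun_prop
  calc ∫⁻ η, G η = ∫⁻ z, G (L z) :=
        (L.measurePreserving.lintegral_comp hGm).symm
    _ = ∫⁻ p in Set.Ioi (0 : ℝ) ×ˢ Set.Ioo (-Real.pi) Real.pi, ENNReal.ofReal p.1 *
          G (L (Complex.polarCoord.symm p)) :=
        (Complex.lintegral_comp_polarCoord_symm fun z => G (L z)).symm
    _ = ∫⁻ θ in Set.Ioo (-Real.pi) Real.pi, ∫⁻ r in Set.Ioi (0 : ℝ), ENNReal.ofReal r *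
          G (L (Complex.polarCoord.symm (r, θ))) := by
        rw [Measure.volume_eq_prod, ← Measure.prod_restrict, lintegral_prod_symm]
        exact hm'.aemeasurable
    _ ≤ ∫⁻ θ in Set.Ioo (-Real.pi) Real.pi, ENNReal.ofReal |Real.sin θ| ^ (-κ) *
          ((ENNReal.ofReal (2 * (1 - m ^ 2)))⁻¹ * ∫⁻ τ, k τ) := by
        refine lintegral_mono fun θ => ?_
        calc ∫⁻ r in Set.Ioi (0 : ℝ), ENNReal.ofReal r * G (L (Complex.polarCoord.symm (r, θ)))
            = ∫⁻ r in Set.Ioi (0 : ℝ), ENNReal.ofReal |Real.sin θ| ^ (-κ) *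
                (S θ).indicator (fun r => k (r + ‖ξ - r • v θ‖)) r :=
              setLIntegral_congr_fun measurableSet_Ioi fun r hr => hpol r θ hr
          _ ≤ ∫⁻ r, ENNReal.ofReal |Real.sin θ| ^ (-κ) *
                (S θ).indicator (fun r => k (r + ‖ξ - r • v θ‖)) r :=
              setLIntegral_le_lintegral _ _
          _ = ENNReal.ofReal |Real.sin θ| ^ (-κ) *
                ∫⁻ r in S θ, k (r + ‖ξ - r • v θ‖) := by
              rw [lintegral_const_mul, lintegral_indicator (hSm θ)]
              refine Measurable.indicator (hk.comp ?_) (hSm θ)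
              exact (by fun_prop : Continuous fun r : ℝ => r + ‖ξ - r • v θ‖).measurable
          _ ≤ _ := by
              gcongr
              exact setLIntegral_phase_ray_le hm0 hm (hvn θ) ξ k
    _ = _ := by
        rw [lintegral_mul_const _ (by fun_prop), angularMass]

/-! ### Comparison of the weights -/

theorem rpow_le_rpow_abs_mul {x y ρ s : ℝ} (hx : 0 < x) (hy : 0 < y) (hρ : 1 ≤ ρ)
    (hxy : x ≤ ρ * y) (hyx : y ≤ ρ * x) : x ^ s ≤ ρ ^ |s| * y ^ s := by
  have hρ0 : 0 < ρ := by linarith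
  rcases le_total 0 s with hs | hs
  · rw [abs_of_nonneg hs, ← Real.mul_rpow hρ0.le hy.le]
    exact Real.rpow_le_rpow hx.le hxy hs
  · rw [abs_of_nonpos hs, Real.rpow_neg hρ0.le, ← Real.inv_rpow hρ0.le,
      ← Real.mul_rpow (by positivity) hy.le]
    exact Real.rpow_le_rpow_of_nonpos (by positivity) ((inv_mul_le_iff₀ hρ0).2 hyx) hs

/-- The interacting frequencies are comparable, so that the powers of the frequencies balance by
scaling. A negative power of the output frequency is paid for by the angular weight, because `‖ξ‖`
is at least the distance from `η` to the line spanned by `ξ - η`. -/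
theorem exists_weight_le {m : ℝ} (hm0 : 0 ≤ m) (hm : m < 1) {s₁ s₂ s₃ : ℝ}
    (hsum : s₁ + s₂ + s₃ = 1 / 2) :
    ∃ C : ℝ, 0 < C ∧ ∀ ξ η : Plane, ξ ≠ 0 → η ≠ 0 → ξ - η ≠ 0 → η ∈ highHighSet m ξ →
      ENNReal.ofReal (‖ξ‖ ^ (-2 * s₃)) * ENNReal.ofReal ‖η‖ ≤
        ENNReal.ofReal C * ENNReal.ofReal (‖η‖ ^ (2 * s₁)) *
          (ENNReal.ofReal (‖ξ - η‖ ^ (2 * s₂)) * angularWeight (max (2 * s₃) 0) η (ξ - η)) := by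
  set ρ := (1 + m) / (1 - m) with hρ
  have h1m : 0 < 1 - m := by linarith
  have hρ1 : 1 ≤ ρ := by rw [hρ, le_div_iff₀ h1m]; linarith
  refine ⟨ρ ^ |2 * s₂| * (1 + ρ) ^ |2 * s₃|, by positivity, fun ξ η hξ hη hζ hA => ?_⟩
  change ‖ξ‖ ≤ m * (‖η‖ + ‖ξ - η‖) at hA
  set L := ‖ξ‖ with hL
  set N := ‖η‖ with hN
  set Z := ‖ξ - η‖ with hZ
  have hL0 : 0 < L := norm_pos_iff.2 hξ
  have hN0 : 0 < N := norm_pos_iff.2 hη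
  have hZ0 : 0 < Z := norm_pos_iff.2 hζ
  have hNZ : N ≤ L + Z := by
    have := norm_sub_le ξ (ξ - η)
    rwa [sub_sub_cancel] at this
  have hZN : Z ≤ L + N := norm_sub_le ξ η
  have hNρ : N ≤ ρ * Z := by
    rw [hρ, div_mul_eq_mul_div, le_div_iff₀ h1m]; nlinarith
  have hZρ : Z ≤ ρ * N := by
    rw [hρ, div_mul_eq_mul_div, le_div_iff₀ h1m]; nlinarith
  have hLN : L ≤ (1 + ρ) * N := by nlinarith
  have hsplit : L ^ (-2 * s₃) * N = N ^ (2 * s₁) * N ^ (2 * s₂) * (L / N) ^ (-2 * s₃) := by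
    rw [Real.div_rpow hL0.le hN0.le, mul_div_assoc', mul_comm _ (L ^ (-2 * s₃)), mul_div_assoc,
      ← Real.rpow_add hN0, ← Real.rpow_sub hN0]
    congr 1
    rw [show 2 * s₁ + 2 * s₂ - -2 * s₃ = 1 by linarith, Real.rpow_one]
  have hN2 : N ^ (2 * s₂) ≤ ρ ^ |2 * s₂| * Z ^ (2 * s₂) := rpow_le_rpow_abs_mul hN0 hZ0 hρ1 hNρ hZρ
  have hang : ENNReal.ofReal ((L / N) ^ (-2 * s₃)) ≤ ENNReal.ofReal ((1 + ρ) ^ |2 * s₃|) *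
      angularWeight (max (2 * s₃) 0) η (ξ - η) := by
    rcases le_total s₃ 0 with hs | hs
    · rw [max_eq_right (by linarith), angularWeight, neg_zero, ENNReal.rpow_zero, mul_one,
        abs_of_nonpos (by linarith)]
      refine ENNReal.ofReal_le_ofReal ?_
      rw [neg_mul]
      exact Real.rpow_le_rpow (by positivity) ((div_le_iff₀ hN0).2 hLN) (by linarith)
    · rw [max_eq_left (by linarith), angularWeight]
      have h1 : 1 ≤ ENNReal.ofReal ((1 + ρ) ^ |2 * s₃|) := by
        rw [ENNReal.one_le_ofReal]
        exact Real.one_le_rpow (by linarith) (abs_nonneg _)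
      refine le_trans ?_ (le_mul_of_one_le_left' h1)
      rw [← ENNReal.ofReal_rpow_of_pos (by positivity), neg_mul, ENNReal.rpow_neg,
        ENNReal.rpow_neg, ENNReal.inv_le_inv]
      refine ENNReal.rpow_le_rpow (ENNReal.ofReal_le_ofReal ?_) (by linarith)
      rw [le_div_iff₀ hN0, mul_comm]
      have := norm_mul_absSin_le η (ξ - η)
      rwa [add_sub_cancel] at this
  calc ENNReal.ofReal (L ^ (-2 * s₃)) * ENNReal.ofReal N
      = ENNReal.ofReal (N ^ (2 * s₁)) * ENNReal.ofReal (N ^ (2 * s₂)) *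
          ENNReal.ofReal ((L / N) ^ (-2 * s₃)) := by
        rw [← ENNReal.ofReal_mul (by positivity), hsplit, ENNReal.ofReal_mul (by positivity),
          ENNReal.ofReal_mul (by positivity)]
    _ ≤ ENNReal.ofReal (N ^ (2 * s₁)) * ENNReal.ofReal (ρ ^ |2 * s₂| * Z ^ (2 * s₂)) *
          (ENNReal.ofReal ((1 + ρ) ^ |2 * s₃|) *
            angularWeight (max (2 * s₃) 0) η (ξ - η)) := by gcongr
    _ = _ := by
        rw [ENNReal.ofReal_mul (by positivity), ENNReal.ofReal_mul (by positivity)]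
        ring

/-! ### The bilinear estimate for Fourier transforms -/

/-- The square of the `L²` norm of `a` with the weight `‖η‖^s`. -/
def weightedSq (s : ℝ) (a : Plane → ℂ) : ℝ≥0∞ :=
  ∫⁻ η, ENNReal.ofReal (‖η‖ ^ (2 * s)) * ‖a η‖ₑ ^ 2

/-- The average of the density of `weightedSq s b` against the angular weight in the direction of
`η`. -/
def angularMean (κ s : ℝ) (b : Plane → ℂ) (η : Plane) : ℝ≥0∞ :=
  ∫⁻ ζ, ENNReal.ofReal (‖ζ‖ ^ (2 * s)) * ‖b ζ‖ₑ ^ 2 * angularWeight κ η ζ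

@[fun_prop]
theorem measurable_ofReal_norm_rpow (s : ℝ) :
    Measurable fun η : Plane => ENNReal.ofReal (‖η‖ ^ s) := by
  fun_prop

theorem measurable_angularMean (κ s : ℝ) {b : Plane → ℂ} (hb : Measurable b) :
    Measurable (angularMean κ s b) := by
  have h : Measurable fun p : Plane × Plane =>
      ENNReal.ofReal (‖p.2‖ ^ (2 * s)) * ‖b p.2‖ₑ ^ 2 * angularWeight κ p.1 p.2 :=
    Measurable.mul (by fun_prop) (measurable_angularWeight κ)
  exact h.lintegral_prod_right'

theorem angularMean_ne_zero {κ s : ℝ} (hκ : 0 ≤ κ) {b : Plane → ℂ} (hb : Continuous b) {ζ : Plane}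
    (hζ : b ζ ≠ 0) (η : Plane) : angularMean κ s b η ≠ 0 := by
  intro h0
  rw [angularMean, lintegral_eq_zero_iff] at h0
  · have hb0 : b =ᵐ[volume] fun _ => 0 := by
      filter_upwards [h0, Measure.ae_ne volume (0 : Plane)] with z hz hz0
      have hpos : 0 < ‖z‖ ^ (2 * s) := Real.rpow_pos_of_pos (norm_pos_iff.2 hz0) _
      simpa [angularWeight_ne_zero κ η z hκ, hpos.not_ge] using hz
    exact hζ (congrFun ((hb.ae_eq_iff_eq volume continuous_const).1 hb0) ζ)
  · have : Measurable fun ζ => angularWeight κ η ζ := (measurable_angularWeight κ).of_uncurry_left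
    exact Measurable.mul (by fun_prop) this

/-- The Schur weight `angularMean κ s b η / ‖η‖` is adapted to the kernels that are functions of
the phase. -/
theorem lintegral_phase_angularMean_le {m : ℝ} (hm0 : 0 ≤ m) (hm : m < 1) (κ s : ℝ)
    {b : Plane → ℂ} (hb : Measurable b) (ξ : Plane) {k : ℝ → ℝ≥0∞} (hk : Measurable k) :
    ∫⁻ η, (highHighSet m ξ).indicator (fun η => k (‖η‖ + ‖ξ - η‖)) η *
        (angularMean κ s b η / ENNReal.ofReal ‖η‖) ≤
      angularMass κ * ((ENNReal.ofReal (2 * (1 - m ^ 2)))⁻¹ * ∫⁻ τ, k τ) * weightedSq s b := by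
  set g : Plane → ℝ≥0∞ := (highHighSet m ξ).indicator (fun η => k (‖η‖ + ‖ξ - η‖)) with hg
  have hgm : Measurable g := by
    have h1 : Measurable fun η : Plane => ‖η‖ + ‖ξ - η‖ := by fun_prop
    exact (hk.comp h1).indicator (measurableSet_highHighSet m ξ)
  set β : Plane → ℝ≥0∞ := fun ζ => ENNReal.ofReal (‖ζ‖ ^ (2 * s)) * ‖b ζ‖ₑ ^ 2 with hβ
  have hβm : Measurable β := by fun_prop
  have hW : Measurable fun p : Plane × Plane => angularWeight κ p.1 p.2 :=
    measurable_angularWeight κ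
  have hW1 : ∀ η, Measurable fun ζ => angularWeight κ η ζ := fun η => hW.of_uncurry_left
  have hW2 : ∀ ζ, Measurable fun η => angularWeight κ η ζ := fun ζ => hW.of_uncurry_right
  calc ∫⁻ η, g η * (angularMean κ s b η / ENNReal.ofReal ‖η‖)
      = ∫⁻ η, ∫⁻ ζ, β ζ * (g η * (angularWeight κ η ζ / ENNReal.ofReal ‖η‖)) := by
        refine lintegral_congr fun η => ?_
        have h : angularMean κ s b η = ∫⁻ ζ, β ζ * angularWeight κ η ζ := rfl
        rw [h, div_eq_mul_inv, mul_comm _ (ENNReal.ofReal ‖η‖)⁻¹, ← mul_assoc,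
          ← lintegral_const_mul _ (f := fun ζ => β ζ * angularWeight κ η ζ) (hβm.mul (hW1 η))]
        refine lintegral_congr fun ζ => ?_
        rw [div_eq_mul_inv]
        ring
    _ = ∫⁻ ζ, ∫⁻ η, β ζ * (g η * (angularWeight κ η ζ / ENNReal.ofReal ‖η‖)) := by
        refine lintegral_lintegral_swap (Measurable.aemeasurable ?_)
        refine (hβm.comp measurable_snd).mul ((hgm.comp measurable_fst).mul (hW.div ?_))
        exact measurable_fst.norm.ennreal_ofReal
    _ ≤ ∫⁻ ζ, angularMass κ * ((ENNReal.ofReal (2 * (1 - m ^ 2)))⁻¹ * ∫⁻ τ, k τ) * β ζ := by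
        refine lintegral_mono_ae ?_
        filter_upwards [Measure.ae_ne volume (0 : Plane)] with ζ hζ
        rw [lintegral_const_mul, mul_comm]
        · gcongr
          exact lintegral_phase_angularWeight_le hm0 hm κ ξ hζ hk
        · exact hgm.mul ((hW2 ζ).div measurable_norm.ennreal_ofReal)
    _ = _ := by rw [lintegral_const_mul _ hβm, weightedSq]

/-- The quadratic form of the interaction kernel at a fixed output frequency `ξ`. -/
theorem lintegral_lintegral_interaction_le {m : ℝ} (hm0 : 0 ≤ m) (hm : m < 1) {κ : ℝ} (hκ0 : 0 ≤ κ)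
    (hκ : κ < 1) (s : ℝ) {a b : Plane → ℂ} (ha : Measurable a) (hb : Continuous b)
    (hbs : weightedSq s b ≠ ∞) (ξ : Plane) {ε : ℝ} (hε : 0 < ε) :
    ∫⁻ x, ∫⁻ y, ‖(highHighSet m ξ).indicator (fun η => a η * b (ξ - η)) x‖ₑ *
        ‖(highHighSet m ξ).indicator (fun η => a η * b (ξ - η)) y‖ₑ *
        ENNReal.ofReal (gaussKernel ε ((‖x‖ + ‖ξ - x‖) - (‖y‖ + ‖ξ - y‖))) ≤
      2 * (angularMass κ * (ENNReal.ofReal (2 * (1 - m ^ 2)))⁻¹ * weightedSq s b) *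
        ∫⁻ η, ‖(highHighSet m ξ).indicator (fun η => a η * b (ξ - η)) η‖ₑ ^ 2 /
          (angularMean κ s b η / ENNReal.ofReal ‖η‖) := by
  set A := highHighSet m ξ with hA
  have hAm : MeasurableSet A := measurableSet_highHighSet m ξ
  set F : Plane → ℂ := A.indicator fun η => a η * b (ξ - η) with hF
  set φ : Plane → ℝ := fun η => ‖η‖ + ‖ξ - η‖ with hφ
  have hφm : Measurable φ := by fun_prop
  have hFm : Measurable F := (ha.mul (hb.measurable.comp (by fun_prop))).indicator hAm
  set D := angularMass κ * (ENNReal.ofReal (2 * (1 - m ^ 2)))⁻¹ * weightedSq s b with hD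
  have hc : ENNReal.ofReal (2 * (1 - m ^ 2)) ≠ 0 := by
    have : 0 < 2 * (1 - m ^ 2) := by nlinarith
    simpa using this
  have hDt : D ≠ ∞ := ENNReal.mul_ne_top (ENNReal.mul_ne_top (angularMass_ne_top hκ0 hκ)
    (ENNReal.inv_ne_top.2 hc)) hbs
  set w : Plane → ℝ≥0∞ := fun η => angularMean κ s b η / ENNReal.ofReal ‖η‖ with hw
  have hwm : Measurable w :=
    (measurable_angularMean κ s hb.measurable).div measurable_norm.ennreal_ofReal
  have hone : ∀ c : ℝ, ∫⁻ y, A.indicator (fun η => ENNReal.ofReal (gaussKernel ε (c - φ η))) y *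
      w y ≤ D := by
    intro c
    have h := lintegral_phase_angularMean_le hm0 hm κ s hb.measurable ξ
      (k := fun τ => ENNReal.ofReal (gaussKernel ε (c - τ))) (by fun_prop)
    rwa [lintegral_sub_left_eq_self (fun τ => ENNReal.ofReal (gaussKernel ε τ)) c,
      lintegral_gaussKernel hε, mul_one] at h
  set K : Plane → Plane → ℝ≥0∞ := fun x y =>
    A.indicator 1 x * A.indicator 1 y * ENNReal.ofReal (gaussKernel ε (φ x - φ y)) with hK
  have h1m : Measurable (A.indicator (1 : Plane → ℝ≥0∞)) := measurable_one.indicator hAm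
  have hKm : Measurable (Function.uncurry K) := by
    refine ((h1m.comp measurable_fst).mul (h1m.comp measurable_snd)).mul ?_
    fun_prop
  have hKle : ∀ x y,
      K x y ≤ A.indicator (fun η => ENNReal.ofReal (gaussKernel ε (φ x - φ η))) y := by
    intro x y
    by_cases hx : x ∈ A <;> by_cases hy : y ∈ A <;> simp [hK, hx, hy]
  have hS := lintegral_lintegral_mul_mul_le_of_schur (μ := volume) (P := fun x => ‖F x‖ₑ) (w := w)
    (K := K) (D := D) hFm.enorm hwm hKm ?_ ?_ ?_
  · refine le_trans (le_of_eq ?_) hS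
    refine lintegral_congr fun x => lintegral_congr fun y => ?_
    by_cases hx : x ∈ A <;> by_cases hy : y ∈ A <;> simp [hK, hF, hφ, hx, hy]
  · intro x y
    simp only [hK]
    rw [mul_comm (A.indicator 1 x), ← gaussKernel_neg, neg_sub]
  · intro x
    refine le_trans (lintegral_mono fun y => ?_) (hone (φ x))
    gcongr
    exact hKle x y
  · -- The Gaussian is positive everywhere, so finiteness of its integral against `w` makes `w`
    -- finite almost everywhere on `A`.
    have hfin : ∀ᵐ y,
        A.indicator (fun η => ENNReal.ofReal (gaussKernel ε (0 - φ η))) y * w y < ∞ := by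
      refine ae_lt_top ?_ ((hone 0).trans_lt hDt.lt_top).ne
      exact Measurable.mul (Measurable.indicator (by fun_prop) hAm) hwm
    filter_upwards [hfin] with x hx hFx
    have hxA : x ∈ A := by
      by_contra h
      simp [hF, h] at hFx
    have hbx : b (ξ - x) ≠ 0 := by
      intro h
      simp [hF, h] at hFx
    constructor
    · simp only [hw, div_eq_mul_inv]
      exact mul_ne_zero (angularMean_ne_zero hκ0 hb hbx x)
        (ENNReal.inv_ne_zero.2 ENNReal.ofReal_ne_top)
    · intro h
      rw [h, Set.indicator_of_mem hxA, ENNReal.mul_top] at hx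
      · exact lt_irrefl _ hx
      · simpa using gaussKernel_pos hε _

/-- Integration over the output frequency: the Schur weight is cancelled by the mean that defines
it. -/
theorem exists_lintegral_output_le {m : ℝ} (hm0 : 0 ≤ m) (hm : m < 1) {s₁ s₂ s₃ : ℝ}
    (hsum : s₁ + s₂ + s₃ = 1 / 2) :
    ∃ C : ℝ, 0 < C ∧ ∀ a b : Plane → ℂ, Measurable a → Measurable b →
      ∫⁻ ξ, ENNReal.ofReal (‖ξ‖ ^ (-2 * s₃)) *
        ∫⁻ η, ‖(highHighSet m ξ).indicator (fun η => a η * b (ξ - η)) η‖ₑ ^ 2 /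
          (angularMean (max (2 * s₃) 0) s₂ b η / ENNReal.ofReal ‖η‖) ≤
      ENNReal.ofReal C * weightedSq s₁ a := by
  obtain ⟨C, hC, hCle⟩ := exists_weight_le hm0 hm hsum
  refine ⟨C, hC, fun a b ha hb => ?_⟩
  set κ := max (2 * s₃) 0 with hκ
  set B := angularMean κ s₂ b with hB
  have hBm : Measurable B := measurable_angularMean κ s₂ hb
  set F : Plane → Plane → ℂ := fun ξ => (highHighSet m ξ).indicator (fun η => a η * b (ξ - η))
    with hF
  have hFm : Measurable (Function.uncurry F) := by
    have h1 : Measurable fun p : Plane × Plane => a p.2 * b (p.1 - p.2) :=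
      (ha.comp measurable_snd).mul (hb.comp (measurable_fst.sub measurable_snd))
    exact h1.indicator (measurableSet_highHighSet_prod m)
  set Q : Plane → Plane → ℝ≥0∞ := fun ξ η =>
    ENNReal.ofReal (‖ξ‖ ^ (-2 * s₃)) * (‖F ξ η‖ₑ ^ 2 / (B η / ENNReal.ofReal ‖η‖)) with hQ
  have hF1 : ∀ ξ, Measurable (F ξ) := fun ξ => hFm.of_uncurry_left
  have hQm : Measurable (Function.uncurry Q) := by
    refine Measurable.mul ((measurable_ofReal_norm_rpow _).comp measurable_fst) ?_
    refine (hFm.enorm.pow_const 2).div ?_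
    exact (hBm.comp measurable_snd).div measurable_snd.norm.ennreal_ofReal
  have hW : ∀ η, Measurable fun ζ => angularWeight κ η ζ :=
    fun η => (measurable_angularWeight κ).of_uncurry_left
  calc _ = ∫⁻ ξ, ∫⁻ η, Q ξ η := by
        refine lintegral_congr fun ξ => ?_
        rw [← lintegral_const_mul]
        exact ((hF1 ξ).enorm.pow_const 2).div (hBm.div measurable_norm.ennreal_ofReal)
    _ = ∫⁻ η, ∫⁻ ξ, Q ξ η := lintegral_lintegral_swap hQm.aemeasurable
    _ ≤ ∫⁻ η, ENNReal.ofReal C * (ENNReal.ofReal (‖η‖ ^ (2 * s₁)) * ‖a η‖ₑ ^ 2) := by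
        refine lintegral_mono_ae ?_
        filter_upwards [Measure.ae_ne volume (0 : Plane)] with η hη
        set c := ENNReal.ofReal C * (ENNReal.ofReal (‖η‖ ^ (2 * s₁)) * ‖a η‖ₑ ^ 2) with hc
        set G : Plane → ℝ≥0∞ := fun ζ =>
          ENNReal.ofReal (‖ζ‖ ^ (2 * s₂)) * ‖b ζ‖ₑ ^ 2 * angularWeight κ η ζ with hG
        have hGm : Measurable G := Measurable.mul (by fun_prop) (hW η)
        calc ∫⁻ ξ, Q ξ η ≤ ∫⁻ ξ, c * (B η)⁻¹ * G (ξ - η) := by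
              refine lintegral_mono_ae ?_
              filter_upwards [Measure.ae_ne volume (0 : Plane), Measure.ae_ne volume η]
                with ξ hξ hξη
              by_cases hA : η ∈ highHighSet m ξ
              · have hη0 : ENNReal.ofReal ‖η‖ ≠ 0 := by simpa using hη
                have hFv : F ξ η = a η * b (ξ - η) := by simp only [hF, Set.indicator_of_mem hA]
                simp only [hQ]
                rw [hFv, enorm_mul, div_eq_mul_inv, ENNReal.inv_div (.inl ENNReal.ofReal_ne_top)
                  (.inl hη0), div_eq_mul_inv]
                calc _ = (ENNReal.ofReal (‖ξ‖ ^ (-2 * s₃)) * ENNReal.ofReal ‖η‖) *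
                      ((B η)⁻¹ * (‖a η‖ₑ * ‖b (ξ - η)‖ₑ) ^ 2) := by ring
                  _ ≤ (ENNReal.ofReal C * ENNReal.ofReal (‖η‖ ^ (2 * s₁)) *
                        (ENNReal.ofReal (‖ξ - η‖ ^ (2 * s₂)) * angularWeight κ η (ξ - η))) *
                      ((B η)⁻¹ * (‖a η‖ₑ * ‖b (ξ - η)‖ₑ) ^ 2) := by
                      exact mul_le_mul' (hCle ξ η hξ hη (sub_ne_zero.2 hξη) hA) le_rfl
                  _ = _ := by simp only [hc, hG]; ring
              · have hFv : F ξ η = 0 := by simp only [hF, Set.indicator_of_notMem hA]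
                simp [hQ, hFv]
          _ = c * (B η)⁻¹ * B η := by
              rw [lintegral_const_mul _ (f := fun ξ => G (ξ - η))
                (hGm.comp (measurable_sub_const η)), lintegral_sub_right_eq_self G η]
              rfl
          _ ≤ c := by
              rw [mul_assoc]
              exact mul_le_of_le_one_right' (ENNReal.inv_mul_le_one _)
    _ = _ := by rw [lintegral_const_mul _ (by fun_prop), weightedSq]

/-- The Fourier transform of `(S₊(t) f, S₊(t) g)_{HH→L}` up to a constant, where `a` and `b` are the
Fourier transforms of `f` and `g`. -/
def interaction (m : ℝ) (a b : Plane → ℂ) (t : ℝ) (ξ : Plane) : ℂ :=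
  ∫ η, (highHighSet m ξ).indicator (fun η => a η * b (ξ - η)) η *
    Complex.exp (-(2 * Real.pi * Complex.I * t * (‖η‖ + ‖ξ - η‖ : ℝ)))

theorem measurable_interaction (m : ℝ) {a b : Plane → ℂ} (ha : Measurable a) (hb : Measurable b) :
    Measurable (Function.uncurry (interaction m a b)) := by
  have hF : Measurable fun p : (ℝ × Plane) × Plane =>
      (highHighSet m p.1.2).indicator (fun η => a η * b (p.1.2 - η)) p.2 := by
    have h1 : Measurable fun p : (ℝ × Plane) × Plane => a p.2 * b (p.1.2 - p.2) := by fun_prop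
    have h2 : Measurable fun p : (ℝ × Plane) × Plane => (p.1.2, p.2) := by fun_prop
    exact h1.indicator (h2 (measurableSet_highHighSet_prod m))
  have hE : Measurable fun p : (ℝ × Plane) × Plane =>
      Complex.exp (-(2 * Real.pi * Complex.I * p.1.1 * (‖p.2‖ + ‖p.1.2 - p.2‖ : ℝ))) := by
    fun_prop
  exact (hF.mul hE).stronglyMeasurable.integral_prod_right.measurable

/-- Removal of the Gaussian regularization, by Fatou's lemma. -/
theorem lintegral_le_of_forall_gaussian {g : ℝ → ℝ≥0∞} (hg : Measurable g) {D : ℝ≥0∞}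
    (h : ∀ ε : ℝ, 0 < ε → ∫⁻ t, ENNReal.ofReal (Real.exp (-Real.pi * ε * t ^ 2)) * g t ≤ D) :
    ∫⁻ t, g t ≤ D := by
  set ε : ℕ → ℝ := fun n => 1 / ((n : ℝ) + 1) with hε
  have hlim : ∀ t, Filter.Tendsto
      (fun n => ENNReal.ofReal (Real.exp (-Real.pi * ε n * t ^ 2)) * g t) Filter.atTop
      (nhds (g t)) := by
    intro t
    have h1 : Filter.Tendsto ε Filter.atTop (nhds 0) := tendsto_one_div_add_atTop_nhds_zero_nat
    have h2 : Filter.Tendsto (fun n => ENNReal.ofReal (Real.exp (-Real.pi * ε n * t ^ 2)))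
        Filter.atTop (nhds 1) := by
      have h3 : Continuous fun x : ℝ => ENNReal.ofReal (Real.exp (-Real.pi * x * t ^ 2)) :=
        ENNReal.continuous_ofReal.comp (by fun_prop)
      simpa [Function.comp_def] using (h3.tendsto 0).comp h1
    simpa using ENNReal.Tendsto.mul_const h2 (.inl one_ne_zero)
  calc ∫⁻ t, g t = ∫⁻ t, Filter.liminf
        (fun n => ENNReal.ofReal (Real.exp (-Real.pi * ε n * t ^ 2)) * g t) Filter.atTop :=
        lintegral_congr fun t => (hlim t).liminf_eq.symm
    _ ≤ Filter.liminf (fun n => ∫⁻ t, ENNReal.ofReal (Real.exp (-Real.pi * ε n * t ^ 2)) * g t)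
          Filter.atTop := lintegral_liminf_le fun n => by fun_prop
    _ ≤ D := by
        refine (Filter.liminf_le_liminf (.of_forall fun n => h (ε n) (by positivity))).trans ?_
        simp

/-- The bilinear space-time estimate, in terms of the Fourier transforms of the data. -/
theorem exists_lintegral_interaction_le {m : ℝ} (hm0 : 0 ≤ m) (hm : m < 1) {s₁ s₂ s₃ : ℝ}
    (hsum : s₁ + s₂ + s₃ = 1 / 2) (hpos : 0 < s₁ + s₂) :
    ∃ C : ℝ, 0 < C ∧ ∀ a b : Plane → ℂ, Measurable a → Continuous b →
      (∀ ξ, Integrable fun η => a η * b (ξ - η)) → weightedSq s₂ b ≠ ∞ →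
      ∫⁻ t, ∫⁻ ξ, ENNReal.ofReal (‖ξ‖ ^ (-2 * s₃)) * ‖interaction m a b t ξ‖ₑ ^ 2 ≤
        ENNReal.ofReal C * (weightedSq s₁ a * weightedSq s₂ b) := by
  obtain ⟨C, hC, hCle⟩ := exists_lintegral_output_le hm0 hm hsum
  set κ := max (2 * s₃) 0 with hκ
  have hκ0 : 0 ≤ κ := le_max_right _ _
  have hκ1 : κ < 1 := max_lt (by linarith) one_pos
  set c₀ := angularMass κ * (ENNReal.ofReal (2 * (1 - m ^ 2)))⁻¹ with hc₀
  have hc : ENNReal.ofReal (2 * (1 - m ^ 2)) ≠ 0 := by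
    have : 0 < 2 * (1 - m ^ 2) := by nlinarith
    simpa using this
  have hct : c₀ ≠ ∞ := ENNReal.mul_ne_top (angularMass_ne_top hκ0 hκ1) (ENNReal.inv_ne_top.2 hc)
  -- The summand `1` only serves to make the constant visibly positive.
  refine ⟨2 * c₀.toReal * C + 1, by positivity, fun a b ha hb hab hbs => ?_⟩
  have hHm := measurable_interaction m ha hb.measurable
  have hgm : Measurable fun p : ℝ × Plane =>
      ENNReal.ofReal (‖p.2‖ ^ (-2 * s₃)) * ‖interaction m a b p.1 p.2‖ₑ ^ 2 :=
    ((measurable_ofReal_norm_rpow _).comp measurable_snd).mul (hHm.enorm.pow_const 2)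
  have hconst : 2 * (c₀ * weightedSq s₂ b) * (ENNReal.ofReal C * weightedSq s₁ a) ≤
      ENNReal.ofReal (2 * c₀.toReal * C + 1) * (weightedSq s₁ a * weightedSq s₂ b) := by
    calc _ = (2 * c₀ * ENNReal.ofReal C) * (weightedSq s₁ a * weightedSq s₂ b) := by ring
      _ ≤ _ := by
        gcongr
        calc 2 * c₀ * ENNReal.ofReal C = ENNReal.ofReal (2 * c₀.toReal * C) := by
              rw [ENNReal.ofReal_mul (by positivity), ENNReal.ofReal_mul (by positivity),
                ENNReal.ofReal_toReal hct, ENNReal.ofReal_ofNat]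
          _ ≤ _ := ENNReal.ofReal_le_ofReal (by linarith)
  refine lintegral_le_of_forall_gaussian hgm.lintegral_prod_right' fun ε hε => ?_
  set F : Plane → Plane → ℂ := fun ξ => (highHighSet m ξ).indicator (fun η => a η * b (ξ - η))
    with hF
  calc ∫⁻ t, ENNReal.ofReal (Real.exp (-Real.pi * ε * t ^ 2)) *
        ∫⁻ ξ, ENNReal.ofReal (‖ξ‖ ^ (-2 * s₃)) * ‖interaction m a b t ξ‖ₑ ^ 2
      = ∫⁻ t, ∫⁻ ξ, ENNReal.ofReal (Real.exp (-Real.pi * ε * t ^ 2)) *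
          (ENNReal.ofReal (‖ξ‖ ^ (-2 * s₃)) * ‖interaction m a b t ξ‖ₑ ^ 2) := by
        refine lintegral_congr fun t => ?_
        have hHt : Measurable (interaction m a b t) := hHm.of_uncurry_left
        rw [lintegral_const_mul]
        exact (measurable_ofReal_norm_rpow _).mul (hHt.enorm.pow_const 2)
    _ = ∫⁻ ξ, ∫⁻ t, ENNReal.ofReal (Real.exp (-Real.pi * ε * t ^ 2)) *
          (ENNReal.ofReal (‖ξ‖ ^ (-2 * s₃)) * ‖interaction m a b t ξ‖ₑ ^ 2) := by
        refine lintegral_lintegral_swap (Measurable.aemeasurable ?_)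
        exact Measurable.mul (by fun_prop) hgm
    _ ≤ ∫⁻ ξ, 2 * (c₀ * weightedSq s₂ b) * (ENNReal.ofReal (‖ξ‖ ^ (-2 * s₃)) *
          ∫⁻ η, ‖F ξ η‖ₑ ^ 2 / (angularMean κ s₂ b η / ENNReal.ofReal ‖η‖)) := by
        refine lintegral_mono fun ξ => ?_
        have hFi : Integrable (F ξ) := (hab ξ).indicator (measurableSet_highHighSet m ξ)
        have hHξ : Measurable fun t => interaction m a b t ξ := hHm.of_uncurry_right
        have h1 := lintegral_gaussian_mul_sq_le hFi (φ := fun η => ‖η‖ + ‖ξ - η‖) (by fun_prop) hε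
        have h2 := lintegral_lintegral_interaction_le hm0 hm hκ0 hκ1 s₂ ha hb hbs ξ hε
        calc _ = ∫⁻ t, ENNReal.ofReal (‖ξ‖ ^ (-2 * s₃)) *
              (ENNReal.ofReal (Real.exp (-Real.pi * ε * t ^ 2)) *
                ‖interaction m a b t ξ‖ₑ ^ 2) := by
              refine lintegral_congr fun t => ?_
              ring
          _ = ENNReal.ofReal (‖ξ‖ ^ (-2 * s₃)) *
              ∫⁻ t, ENNReal.ofReal (Real.exp (-Real.pi * ε * t ^ 2)) *
                ‖interaction m a b t ξ‖ₑ ^ 2 := by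
              rw [lintegral_const_mul]
              exact Measurable.mul (by fun_prop) (hHξ.enorm.pow_const 2)
          _ ≤ ENNReal.ofReal (‖ξ‖ ^ (-2 * s₃)) * (2 * (c₀ * weightedSq s₂ b) *
                ∫⁻ η, ‖F ξ η‖ₑ ^ 2 / (angularMean κ s₂ b η / ENNReal.ofReal ‖η‖)) := by
              gcongr
              exact h1.trans h2
          _ = _ := by ring
    _ = 2 * (c₀ * weightedSq s₂ b) * ∫⁻ ξ, ENNReal.ofReal (‖ξ‖ ^ (-2 * s₃)) *
          ∫⁻ η, ‖F ξ η‖ₑ ^ 2 / (angularMean κ s₂ b η / ENNReal.ofReal ‖η‖) := by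
        rw [lintegral_const_mul' _ _ ?_]
        exact ENNReal.mul_ne_top ENNReal.ofNat_ne_top (ENNReal.mul_ne_top hct hbs)
    _ ≤ 2 * (c₀ * weightedSq s₂ b) * (ENNReal.ofReal C * weightedSq s₁ a) := by
        gcongr
        exact hCle a b ha hb.measurable
    _ ≤ _ := hconst

/-! ### Square integrability and continuity in time -/

theorem eLpNorm_two_sq {α E : Type*} [MeasurableSpace α] [NormedAddCommGroup E] (f : α → E)
    (μ : Measure α) : eLpNorm f 2 μ ^ 2 = ∫⁻ x, ‖f x‖ₑ ^ 2 ∂μ := by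
  have := eLpNorm_nnreal_pow_eq_lintegral (f := f) (μ := μ) (p := 2) two_ne_zero
  simpa using this

/-- In polar coordinates the integrand is `y^{2p+1} (1 + y)^{-8}`, with `-1 < 2p + 1 < 3`. -/
theorem integrable_norm_rpow_mul_one_add_norm {p : ℝ} (hp : |p| < 1) :
    Integrable fun ξ : Plane => ‖ξ‖ ^ (2 * p) * ((1 + ‖ξ‖) ^ 8)⁻¹ := by
  obtain ⟨hp1, hp2⟩ := abs_lt.1 hp
  rw [integrable_fun_norm_addHaar (volume : Measure Plane)
    (f := fun y : ℝ => y ^ (2 * p) * ((1 + y) ^ 8)⁻¹)]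
  have hdim : Module.finrank ℝ Plane - 1 = 1 := by simp
  rw [hdim]
  have hm : Measurable fun y : ℝ => y ^ 1 • (y ^ (2 * p) * ((1 + y) ^ 8)⁻¹) := by fun_prop
  have hval : ∀ y : ℝ, 0 < y → y ^ 1 • (y ^ (2 * p) * ((1 + y) ^ 8)⁻¹) =
      y ^ (2 * p + 1) * ((1 + y) ^ 8)⁻¹ := by
    intro y hy
    rw [Real.rpow_add hy, Real.rpow_one, smul_eq_mul]
    ring
  rw [← Set.Ioc_union_Ioi_eq_Ioi (zero_le_one' ℝ)]
  refine IntegrableOn.union ?_ ?_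
  · have h0 : IntegrableOn (fun y : ℝ => y ^ (2 * p + 1)) (Set.Ioc 0 1) :=
      (intervalIntegrable_iff_integrableOn_Ioc_of_le zero_le_one).1
        (intervalIntegral.intervalIntegrable_rpow' (by linarith))
    refine Integrable.mono' h0 hm.aestronglyMeasurable ?_
    refine (ae_restrict_iff' measurableSet_Ioc).2 (.of_forall fun y hy => ?_)
    have hy0 := hy.1
    rw [hval y hy0, Real.norm_of_nonneg (by positivity)]
    refine mul_le_of_le_one_right (by positivity) (inv_le_one_of_one_le₀ ?_)
    exact one_le_pow₀ (by linarith)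
  · have h0 : IntegrableOn (fun y : ℝ => y ^ (2 * p + 1 - 8)) (Set.Ioi 1) :=
      integrableOn_Ioi_rpow_of_lt (by linarith) one_pos
    refine Integrable.mono' h0 hm.aestronglyMeasurable ?_
    refine (ae_restrict_iff' measurableSet_Ioi).2 (.of_forall fun y hy => ?_)
    have hy0 : 0 < y := one_pos.trans hy
    rw [hval y hy0, Real.norm_of_nonneg (by positivity), Real.rpow_sub hy0, div_eq_mul_inv]
    gcongr
    rw [show (8 : ℝ) = ((8 : ℕ) : ℝ) by norm_num, Real.rpow_natCast]
    gcongr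
    linarith

/-- A decaying function stays square integrable when multiplied by a power `‖ξ‖^p` with
`|p| < 1`. -/
theorem memLp_norm_rpow_mul {p : ℝ} (hp : |p| < 1) {F : Plane → ℂ} (hF : Measurable F) {C : ℝ}
    (hC : ∀ ξ, ‖F ξ‖ ≤ C * ((1 + ‖ξ‖) ^ 4)⁻¹) :
    MemLp (fun ξ => ((‖ξ‖ ^ p : ℝ) : ℂ) * F ξ) 2 (volume : Measure Plane) := by
  have hm : Measurable fun ξ => ((‖ξ‖ ^ p : ℝ) : ℂ) * F ξ := by fun_prop
  rw [memLp_two_iff_integrable_sq_norm hm.aestronglyMeasurable]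
  refine ((integrable_norm_rpow_mul_one_add_norm hp).const_mul (C ^ 2)).mono'
    (hm.norm.pow_const 2).aestronglyMeasurable (.of_forall fun ξ => ?_)
  rw [Real.norm_of_nonneg (by positivity), norm_mul, Complex.norm_real,
    Real.norm_of_nonneg (by positivity), mul_pow, mul_comm 2 p, Real.rpow_mul (norm_nonneg _),
    Real.rpow_two]
  calc (‖ξ‖ ^ p) ^ 2 * ‖F ξ‖ ^ 2 ≤ (‖ξ‖ ^ p) ^ 2 * (C * ((1 + ‖ξ‖) ^ 4)⁻¹) ^ 2 := by
        gcongr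
        exact hC ξ
    _ = _ := by
        rw [mul_pow, inv_pow, ← pow_mul]
        ring

theorem exists_schwartz_decay (a : 𝓢(Plane, ℂ)) :
    ∃ C : ℝ, 0 ≤ C ∧ ∀ ξ, ‖a ξ‖ ≤ C * ((1 + ‖ξ‖) ^ 8)⁻¹ := by
  refine ⟨2 ^ 8 * (Finset.Iic ((8, 0) : ℕ × ℕ)).sup
    (fun m => SchwartzMap.seminorm ℝ m.1 m.2) a, by positivity, fun ξ => ?_⟩
  have h := SchwartzMap.one_add_le_sup_seminorm_apply (𝕜 := ℝ) (m := (8, 0)) (k := 8) (n := 0)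
    le_rfl le_rfl a ξ
  rw [norm_iteratedFDeriv_zero] at h
  rw [← div_eq_mul_inv, le_div_iff₀ (by positivity), mul_comm]
  exact h

theorem integrable_one_add_norm_pow_four : Integrable fun η : Plane => ((1 + ‖η‖) ^ 4)⁻¹ := by
  have h : Integrable fun η : Plane => (1 + ‖η‖) ^ (-4 : ℝ) :=
    integrable_one_add_norm (by simp; norm_num)
  refine h.congr (.of_forall fun η => ?_)
  have : (0 : ℝ) ≤ 1 + ‖η‖ := by positivity
  simp only [Real.rpow_neg this]
  norm_cast

/-- The convolution of two decaying functions decays. -/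
theorem norm_mul_sub_le {a b : Plane → ℂ} {Ca Cb : ℝ} (hCa : 0 ≤ Ca) (hCb : 0 ≤ Cb)
    (ha : ∀ ξ, ‖a ξ‖ ≤ Ca * ((1 + ‖ξ‖) ^ 8)⁻¹) (hb : ∀ ξ, ‖b ξ‖ ≤ Cb * ((1 + ‖ξ‖) ^ 8)⁻¹)
    (ξ η : Plane) :
    ‖a η * b (ξ - η)‖ ≤ Ca * Cb * ((1 + ‖ξ‖) ^ 4)⁻¹ * ((1 + ‖η‖) ^ 4)⁻¹ := by
  set x := 1 + ‖η‖
  set y := 1 + ‖ξ - η‖ with hy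
  have hx : 1 ≤ x := le_add_of_nonneg_right (norm_nonneg _)
  have hy1 : 1 ≤ y := le_add_of_nonneg_right (norm_nonneg _)
  have hxy : 1 + ‖ξ‖ ≤ x * y := by
    have : ‖ξ‖ ≤ ‖η‖ + ‖ξ - η‖ := by
      have := norm_add_le η (ξ - η)
      rwa [add_sub_cancel] at this
    nlinarith [mul_nonneg (norm_nonneg η) (norm_nonneg (ξ - η))]
  have h1 : (1 + ‖ξ‖) ^ 4 * x ^ 4 ≤ x ^ 8 * y ^ 8 := by
    calc (1 + ‖ξ‖) ^ 4 * x ^ 4 ≤ (x * y) ^ 4 * x ^ 4 := by gcongr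
      _ = x ^ 8 * y ^ 4 := by ring
      _ ≤ x ^ 8 * y ^ 8 := by
          gcongr
          norm_num
  rw [norm_mul]
  calc ‖a η‖ * ‖b (ξ - η)‖ ≤ (Ca * (x ^ 8)⁻¹) * (Cb * (y ^ 8)⁻¹) :=
        mul_le_mul (ha η) (hb _) (norm_nonneg _) (by positivity)
    _ = Ca * Cb * (x ^ 8 * y ^ 8)⁻¹ := by rw [mul_inv]; ring
    _ ≤ Ca * Cb * ((1 + ‖ξ‖) ^ 4 * x ^ 4)⁻¹ := by gcongr
    _ = _ := by rw [mul_inv]; ring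

theorem integrable_mul_sub {a b : Plane → ℂ} (ham : Measurable a) (hbm : Measurable b)
    {Ca Cb : ℝ} (hCa : 0 ≤ Ca) (hCb : 0 ≤ Cb)
    (ha : ∀ ξ, ‖a ξ‖ ≤ Ca * ((1 + ‖ξ‖) ^ 8)⁻¹) (hb : ∀ ξ, ‖b ξ‖ ≤ Cb * ((1 + ‖ξ‖) ^ 8)⁻¹)
    (ξ : Plane) : Integrable fun η => a η * b (ξ - η) := by
  have hm : Measurable fun η => a η * b (ξ - η) := by fun_prop
  exact (integrable_one_add_norm_pow_four.const_mul _).mono' hm.aestronglyMeasurable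
    (.of_forall fun η => norm_mul_sub_le hCa hCb ha hb ξ η)

theorem norm_exp_neg_two_pi_mul (t s : ℝ) :
    ‖Complex.exp (-(2 * Real.pi * Complex.I * t * (s : ℝ)))‖ = 1 := by
  have : -(2 * Real.pi * Complex.I * t * s) = ((-(2 * Real.pi * t * s) : ℝ) : ℂ) * Complex.I := by
    push_cast; ring
  rw [this, Complex.norm_exp_ofReal_mul_I]

theorem norm_interaction_integrand_le (m : ℝ) (a b : Plane → ℂ) (t : ℝ) (ξ η : Plane) :
    ‖(highHighSet m ξ).indicator (fun η => a η * b (ξ - η)) η *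
      Complex.exp (-(2 * Real.pi * Complex.I * t * (‖η‖ + ‖ξ - η‖ : ℝ)))‖ ≤
      ‖a η * b (ξ - η)‖ := by
  rw [norm_mul, norm_exp_neg_two_pi_mul, mul_one]
  exact norm_indicator_le_norm_self _ _

theorem norm_interaction_le (m : ℝ) {a b : Plane → ℂ}
    {Ca Cb : ℝ} (hCa : 0 ≤ Ca) (hCb : 0 ≤ Cb)
    (ha : ∀ ξ, ‖a ξ‖ ≤ Ca * ((1 + ‖ξ‖) ^ 8)⁻¹) (hb : ∀ ξ, ‖b ξ‖ ≤ Cb * ((1 + ‖ξ‖) ^ 8)⁻¹)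
    (t : ℝ) (ξ : Plane) :
    ‖interaction m a b t ξ‖ ≤
      (Ca * Cb * ∫ η : Plane, ((1 + ‖η‖) ^ 4)⁻¹) * ((1 + ‖ξ‖) ^ 4)⁻¹ := by
  have h := norm_integral_le_of_norm_le (integrable_one_add_norm_pow_four.const_mul
    (Ca * Cb * ((1 + ‖ξ‖) ^ 4)⁻¹)) (.of_forall fun η =>
      (norm_interaction_integrand_le m a b t ξ η).trans (norm_mul_sub_le hCa hCb ha hb ξ η))
  rw [integral_const_mul] at h
  refine h.trans (le_of_eq ?_)
  ring

theorem continuous_interaction (m : ℝ) {a b : Plane → ℂ} (ham : Measurable a) (hbm : Measurable b)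
    {ξ : Plane} (hi : Integrable fun η => a η * b (ξ - η)) :
    Continuous fun t => interaction m a b t ξ := by
  refine continuous_of_dominated (bound := fun η => ‖a η * b (ξ - η)‖) (fun t => ?_)
    (fun t => .of_forall fun η => norm_interaction_integrand_le m a b t ξ η) hi.norm
    (.of_forall fun η => by fun_prop)
  have h1 : Measurable fun η => a η * b (ξ - η) := by fun_prop
  have h2 : Measurable fun η : Plane =>
    Complex.exp (-(2 * Real.pi * Complex.I * t * (‖η‖ + ‖ξ - η‖ : ℝ))) := by fun_prop
  exact ((h1.indicator (measurableSet_highHighSet m ξ)).mul h2).aestronglyMeasurable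

/-- Dominated convergence for `L²`-valued functions. -/
theorem continuous_toLp_of_dominated {α : Type*} [MeasurableSpace α] {μ : Measure α}
    {W : ℝ → α → ℂ} (hW : ∀ t, MemLp (W t) 2 μ) {g : α → ℂ} (hg : MemLp g 2 μ)
    (hbound : ∀ t x, ‖W t x‖ ≤ ‖g x‖) (hcont : ∀ x, Continuous fun t => W t x) :
    Continuous fun t => (hW t).toLp (W t) := by
  rw [continuous_iff_continuousAt]
  intro t₀
  rw [ContinuousAt, Lp.tendsto_Lp_iff_tendsto_eLpNorm'' W hW (W t₀) (hW t₀)]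
  have hsq : Filter.Tendsto (fun t => ∫⁻ x, ‖(W t - W t₀) x‖ₑ ^ 2 ∂μ) (nhds t₀)
      (nhds (∫⁻ _, 0 ∂μ)) := by
    refine tendsto_lintegral_filter_of_dominated_convergence' (fun x => (2 * ‖g x‖ₑ) ^ 2)
      (.of_forall fun t => ?_) (.of_forall fun t => .of_forall fun x => ?_) ?_
      (.of_forall fun x => ?_)
    · exact ((hW t).1.sub (hW t₀).1).enorm.pow_const 2
    · gcongr
      have hb : ∀ t, ‖W t x‖ₑ ≤ ‖g x‖ₑ := fun t => enorm_le_iff_norm_le.2 (hbound t x)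
      calc ‖W t x - W t₀ x‖ₑ ≤ ‖W t x‖ₑ + ‖W t₀ x‖ₑ := enorm_sub_le
        _ ≤ ‖g x‖ₑ + ‖g x‖ₑ := add_le_add (hb t) (hb t₀)
        _ = 2 * ‖g x‖ₑ := by ring
    · simp_rw [mul_pow]
      rw [lintegral_const_mul' _ _ (by simp), ← eLpNorm_two_sq]
      exact ENNReal.mul_ne_top (by simp) (ENNReal.pow_ne_top hg.2.ne)
    · have h : Continuous fun t => ‖(W t - W t₀) x‖ₑ ^ 2 := by
        have : Continuous fun t => W t x - W t₀ x := (hcont x).sub continuous_const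
        exact (ENNReal.continuous_pow 2).comp this.enorm
      simpa using h.tendsto t₀
  simp only [lintegral_zero, ← eLpNorm_two_sq] at hsq
  have hroot := ((ENNReal.continuous_rpow_const (y := 1 / 2)).tendsto 0).comp hsq
  have h0 : (0 : ℝ≥0∞) ^ (1 / 2 : ℝ) = 0 := ENNReal.zero_rpow_of_pos (by norm_num)
  rw [h0] at hroot
  refine hroot.congr fun t => ?_
  simp only [Function.comp_apply]
  rw [← ENNReal.rpow_natCast, ← ENNReal.rpow_mul]
  norm_num

/-! ### The operators on the Fourier side -/

theorem fourier_ofFourier_ae {F : Plane → ℂ} (h : MemLp F 2 (volume : Measure Plane)) :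
    (𝓕 (ofFourier F) : PlaneL2) =ᵐ[volume] F := by
  rw [ofFourier, dif_pos h, FourierTransform.fourier_fourierInv_eq]
  exact h.coeFn_toLp

theorem enorm_ofFourier_sq {F : Plane → ℂ} (h : MemLp F 2 (volume : Measure Plane)) :
    ‖ofFourier F‖ₑ ^ 2 = ∫⁻ ξ, ‖F ξ‖ₑ ^ 2 := by
  have h1 : ‖ofFourier F‖ = ‖h.toLp F‖ := by
    rw [ofFourier, dif_pos h]
    exact (Lp.fourierTransformₗᵢ Plane ℂ).symm.norm_map _
  rw [← ofReal_norm, h1, ofReal_norm, Lp.enorm_def, eLpNorm_congr_ae h.coeFn_toLp,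
    eLpNorm_two_sq]

theorem ofFourier_congr_ae {F G : Plane → ℂ} (h : F =ᵐ[volume] G) : ofFourier F = ofFourier G := by
  by_cases hF : MemLp F 2 (volume : Measure Plane)
  · have hG := hF.ae_eq h
    rw [ofFourier, ofFourier, dif_pos hF, dif_pos hG, MemLp.toLp_congr hF hG h]
  · have hG : ¬ MemLp G 2 (volume : Measure Plane) := fun hG => hF (hG.ae_eq h.symm)
    rw [ofFourier, ofFourier, dif_neg hF, dif_neg hG]

theorem multiplierFourier_ae (φ : Plane → ℂ) {f : PlaneL2} {a : Plane → ℂ}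
    (h : (𝓕 f : PlaneL2) =ᵐ[volume] a) :
    multiplierFourier φ f =ᵐ[volume] fun ξ => φ ((2 * Real.pi) • ξ) * a ξ := by
  filter_upwards [h] with ξ hξ
  rw [multiplierFourier, hξ]

theorem fourier_toLp_ae (f : 𝓢(Plane, ℂ)) :
    (𝓕 (f.toLp 2) : PlaneL2) =ᵐ[volume] (𝓕 f : 𝓢(Plane, ℂ)) := by
  rw [SchwartzMap.toLp_fourier_eq]
  exact SchwartzMap.coeFn_toLp _ _ _

theorem absPowSymbol_two_pi_smul (s : ℝ) (ξ : Plane) :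
    absPowSymbol s ((2 * Real.pi) • ξ) =
      (((2 * Real.pi) ^ s : ℝ) : ℂ) * ((‖ξ‖ ^ s : ℝ) : ℂ) := by
  rw [absPowSymbol, norm_smul, Real.norm_of_nonneg (by positivity),
    Real.mul_rpow (by positivity) (norm_nonneg _), Complex.ofReal_mul]

theorem enorm_ofReal_rpow_sq {x : ℝ} (hx : 0 ≤ x) (s : ℝ) :
    ‖((x ^ s : ℝ) : ℂ)‖ₑ ^ 2 = ENNReal.ofReal (x ^ (2 * s)) := by
  rw [← ofReal_norm, Complex.norm_real, Real.norm_of_nonneg (by positivity),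
    ← ENNReal.ofReal_pow (by positivity), mul_comm 2 s, Real.rpow_mul hx, Real.rpow_two]

theorem memLp_absPowSymbol_mul {p : ℝ} (hp : |p| < 1) {F : Plane → ℂ} (hF : Measurable F) {C : ℝ}
    (hC : ∀ ξ, ‖F ξ‖ ≤ C * ((1 + ‖ξ‖) ^ 4)⁻¹) :
    MemLp (fun ξ => absPowSymbol p ((2 * Real.pi) • ξ) * F ξ) 2 (volume : Measure Plane) := by
  simp_rw [absPowSymbol_two_pi_smul, mul_assoc]
  exact (memLp_norm_rpow_mul hp hF hC).const_mul _

theorem lintegral_absPowSymbol_mul (s : ℝ) {a : Plane → ℂ} (ha : Measurable a) :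
    ∫⁻ ξ, ‖absPowSymbol s ((2 * Real.pi) • ξ) * a ξ‖ₑ ^ 2 =
      ENNReal.ofReal ((2 * Real.pi) ^ (2 * s)) * weightedSq s a := by
  rw [weightedSq, ← lintegral_const_mul _ (by fun_prop)]
  refine lintegral_congr fun ξ => ?_
  rw [absPowSymbol_two_pi_smul, enorm_mul, enorm_mul, mul_pow, mul_pow,
    enorm_ofReal_rpow_sq (by positivity), enorm_ofReal_rpow_sq (norm_nonneg _), mul_assoc]

theorem inv_one_add_pow_le (ξ : Plane) : ((1 + ‖ξ‖) ^ 8)⁻¹ ≤ ((1 + ‖ξ‖) ^ 4)⁻¹ := by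
  have h : 1 ≤ 1 + ‖ξ‖ := le_add_of_nonneg_right (norm_nonneg _)
  gcongr
  norm_num

theorem memLp_absPowSymbol_mul_schwartz {p : ℝ} (hp : |p| < 1) (a : 𝓢(Plane, ℂ)) :
    MemLp (fun ξ => absPowSymbol p ((2 * Real.pi) • ξ) * a ξ) 2 (volume : Measure Plane) := by
  obtain ⟨C, hC0, hC⟩ := exists_schwartz_decay a
  refine memLp_absPowSymbol_mul hp a.continuous.measurable (C := C) fun ξ => (hC ξ).trans ?_
  exact mul_le_mul_of_nonneg_left (inv_one_add_pow_le ξ) hC0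

theorem inMultiplierDomain_absPowSymbol {p : ℝ} (hp : |p| < 1) (f : 𝓢(Plane, ℂ)) :
    InMultiplierDomain (absPowSymbol p) (f.toLp 2) :=
  (memLp_absPowSymbol_mul_schwartz hp (𝓕 f)).ae_eq
    (multiplierFourier_ae _ (fourier_toLp_ae f)).symm

theorem ofReal_homSobolevNorm_sq {s : ℝ} (hs : |s| < 1) (f : 𝓢(Plane, ℂ)) :
    ENNReal.ofReal (homSobolevNorm s (f.toLp 2)) ^ 2 =
      ENNReal.ofReal ((2 * Real.pi) ^ (2 * s)) * weightedSq s (𝓕 f : 𝓢(Plane, ℂ)) := by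
  rw [homSobolevNorm, ofReal_norm, absD, multiplier,
    ofFourier_congr_ae (multiplierFourier_ae _ (fourier_toLp_ae f)),
    enorm_ofFourier_sq (memLp_absPowSymbol_mul_schwartz hs _),
    lintegral_absPowSymbol_mul _ (𝓕 f : 𝓢(Plane, ℂ)).continuous.measurable]

/-- The phase of the free wave in the normalization of `𝓕`. -/
def wavePhase (t : ℝ) (ξ : Plane) : ℂ := Complex.exp (-(2 * Real.pi * Complex.I * t * (‖ξ‖ : ℝ)))

theorem fourier_propagatorPlus_ae (t : ℝ) (f : 𝓢(Plane, ℂ)) :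
    (𝓕 (propagatorPlus t (f.toLp 2)) : PlaneL2) =ᵐ[volume]
      fun ξ => wavePhase t ξ * (𝓕 f : 𝓢(Plane, ℂ)) ξ := by
  have h : multiplierFourier (fun ξ => Complex.exp (-(Complex.I * (t : ℂ) * (‖ξ‖ : ℂ))))
      (f.toLp 2) =ᵐ[volume] fun ξ => wavePhase t ξ * (𝓕 f : 𝓢(Plane, ℂ)) ξ := by
    refine (multiplierFourier_ae _ (fourier_toLp_ae f)).trans (.of_forall fun ξ => ?_)
    simp only
    rw [wavePhase, norm_smul, Real.norm_of_nonneg (by positivity)]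
    congr 2
    push_cast
    ring
  have hmem : MemLp (fun ξ => wavePhase t ξ * (𝓕 f : 𝓢(Plane, ℂ)) ξ) 2
      (volume : Measure Plane) := by
    refine ((𝓕 f : 𝓢(Plane, ℂ)).memLp 2 volume).of_le ?_ (.of_forall fun ξ => ?_)
    · have h1 : Measurable (wavePhase t) := by unfold wavePhase; fun_prop
      exact (h1.mul (𝓕 f : 𝓢(Plane, ℂ)).continuous.measurable).aestronglyMeasurable
    · rw [norm_mul, wavePhase, norm_exp_neg_two_pi_mul, one_mul]
  rw [propagatorPlus, multiplier, ofFourier_congr_ae h]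
  exact fourier_ofFourier_ae hmem

theorem highHighLowFourier_propagatorPlus (M t : ℝ) (f g : 𝓢(Plane, ℂ)) (ξ : Plane) :
    highHighLowFourier M (propagatorPlus t (f.toLp 2)) (propagatorPlus t (g.toLp 2)) ξ =
      (2 * (Real.pi : ℂ)) ^ 2 *
        interaction M⁻¹ (𝓕 f : 𝓢(Plane, ℂ)) (𝓕 g : 𝓢(Plane, ℂ)) t ξ := by
  rw [highHighLowFourier, interaction]
  congr 1
  refine integral_congr_ae ?_
  have hg := (Measure.measurePreserving_sub_left (volume : Measure Plane)
    ξ).quasiMeasurePreserving.ae_eq_comp (fourier_propagatorPlus_ae t g)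
  filter_upwards [fourier_propagatorPlus_ae t f, hg] with η hη hη'
  simp only [Function.comp_apply] at hη'
  have hset : {η : Plane | ‖ξ‖ ≤ M⁻¹ * (‖η‖ + ‖ξ - η‖)} = highHighSet M⁻¹ ξ := rfl
  rw [hset]
  by_cases hA : η ∈ highHighSet M⁻¹ ξ
  · rw [Set.indicator_of_mem hA, Set.indicator_of_mem hA, hη, hη', wavePhase, wavePhase,
      mul_mul_mul_comm, ← Complex.exp_add, mul_comm]
    congr 2
    push_cast
    ring
  · rw [Set.indicator_of_notMem hA, Set.indicator_of_notMem hA, zero_mul]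

/-! ### The interaction of two free waves -/

/-- The Fourier transform of `|D|^p (S₊(t) f, S₊(t) g)_{HH→L}`, where `a` and `b` are the Fourier
transforms of `f` and `g`. -/
def outputFourier (m p : ℝ) (a b : Plane → ℂ) (t : ℝ) (ξ : Plane) : ℂ :=
  absPowSymbol p ((2 * Real.pi) • ξ) * ((2 * (Real.pi : ℂ)) ^ 2 * interaction m a b t ξ)

theorem measurable_const_mul_interaction (m : ℝ) (a b : 𝓢(Plane, ℂ)) (t : ℝ) :
    Measurable fun ξ => (2 * (Real.pi : ℂ)) ^ 2 * interaction m a b t ξ :=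
  ((measurable_interaction m a.continuous.measurable
    b.continuous.measurable).of_uncurry_left (x := t)).const_mul _

theorem exists_norm_const_mul_interaction_le (m : ℝ) (a b : 𝓢(Plane, ℂ)) :
    ∃ C : ℝ, ∀ t ξ,
      ‖(2 * (Real.pi : ℂ)) ^ 2 * interaction m a b t ξ‖ ≤ C * ((1 + ‖ξ‖) ^ 4)⁻¹ := by
  obtain ⟨Ca, hCa, hda⟩ := exists_schwartz_decay a
  obtain ⟨Cb, hCb, hdb⟩ := exists_schwartz_decay b
  refine ⟨‖(2 * (Real.pi : ℂ)) ^ 2‖ * (Ca * Cb * ∫ η : Plane, ((1 + ‖η‖) ^ 4)⁻¹), fun t ξ => ?_⟩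
  rw [norm_mul, mul_assoc]
  exact mul_le_mul_of_nonneg_left (norm_interaction_le m hCa hCb hda hdb t ξ) (norm_nonneg _)

theorem integrable_schwartz_mul_sub (a b : 𝓢(Plane, ℂ)) (ξ : Plane) :
    Integrable fun η => a η * b (ξ - η) := by
  obtain ⟨Ca, hCa, hda⟩ := exists_schwartz_decay a
  obtain ⟨Cb, hCb, hdb⟩ := exists_schwartz_decay b
  exact integrable_mul_sub a.continuous.measurable b.continuous.measurable hCa hCb hda hdb ξ

theorem memLp_const_mul_interaction (m : ℝ) (a b : 𝓢(Plane, ℂ)) (t : ℝ) :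
    MemLp (fun ξ => (2 * (Real.pi : ℂ)) ^ 2 * interaction m a b t ξ) 2
      (volume : Measure Plane) := by
  obtain ⟨C, hC⟩ := exists_norm_const_mul_interaction_le m a b
  have := memLp_norm_rpow_mul (p := 0) (by simp) (measurable_const_mul_interaction m a b t) (hC t)
  simpa only [Real.rpow_zero, Complex.ofReal_one, one_mul] using this

theorem memLp_outputFourier (m : ℝ) {p : ℝ} (hp : |p| < 1) (a b : 𝓢(Plane, ℂ)) (t : ℝ) :
    MemLp (outputFourier m p a b t) 2 (volume : Measure Plane) := by
  obtain ⟨C, hC⟩ := exists_norm_const_mul_interaction_le m a b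
  exact memLp_absPowSymbol_mul hp (measurable_const_mul_interaction m a b t) (hC t)

theorem continuous_toLp_outputFourier (m : ℝ) {p : ℝ} (hp : |p| < 1) (a b : 𝓢(Plane, ℂ)) :
    Continuous fun t => (memLp_outputFourier m hp a b t).toLp (outputFourier m p a b t) := by
  obtain ⟨C, hC⟩ := exists_norm_const_mul_interaction_le m a b
  have hgm : Measurable fun ξ : Plane => ((C * ((1 + ‖ξ‖) ^ 4)⁻¹ : ℝ) : ℂ) := by fun_prop
  refine continuous_toLp_of_dominated (memLp_outputFourier m hp a b)
    (memLp_absPowSymbol_mul hp hgm (C := |C|) fun ξ => ?_) (fun t ξ => ?_) fun ξ => ?_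
  · rw [Complex.norm_real, norm_mul, Real.norm_eq_abs, Real.norm_of_nonneg (by positivity)]
  · rw [outputFourier, norm_mul _ ((2 * (Real.pi : ℂ)) ^ 2 * _),
      norm_mul _ ((C * ((1 + ‖ξ‖) ^ 4)⁻¹ : ℝ) : ℂ), Complex.norm_real]
    exact mul_le_mul_of_nonneg_left ((hC t ξ).trans (le_abs_self _)) (norm_nonneg _)
  · exact continuous_const.mul (continuous_const.mul (continuous_interaction m
      a.continuous.measurable b.continuous.measurable (integrable_schwartz_mul_sub a b ξ)))

theorem highHighLowFourier_eq (M t : ℝ) (f g : 𝓢(Plane, ℂ)) :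
    highHighLowFourier M (propagatorPlus t (f.toLp 2)) (propagatorPlus t (g.toLp 2)) =
      fun ξ => (2 * (Real.pi : ℂ)) ^ 2 *
        interaction M⁻¹ (𝓕 f : 𝓢(Plane, ℂ)) (𝓕 g : 𝓢(Plane, ℂ)) t ξ :=
  funext fun ξ => highHighLowFourier_propagatorPlus M t f g ξ

theorem multiplierFourier_highHighLow_ae (M p t : ℝ) (f g : 𝓢(Plane, ℂ)) :
    multiplierFourier (absPowSymbol p)
        (highHighLow M (propagatorPlus t (f.toLp 2)) (propagatorPlus t (g.toLp 2)))
      =ᵐ[volume] outputFourier M⁻¹ p (𝓕 f : 𝓢(Plane, ℂ)) (𝓕 g : 𝓢(Plane, ℂ)) t := by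
  refine multiplierFourier_ae _ ?_
  rw [highHighLow, highHighLowFourier_eq]
  exact fourier_ofFourier_ae (memLp_const_mul_interaction M⁻¹ _ _ t)

theorem waveInteraction_eq (M s t : ℝ) (f g : 𝓢(Plane, ℂ)) :
    waveInteraction M s (f.toLp 2) (g.toLp 2) t =
      ofFourier (outputFourier M⁻¹ (-s) (𝓕 f : 𝓢(Plane, ℂ)) (𝓕 g : 𝓢(Plane, ℂ)) t) :=
  ofFourier_congr_ae (multiplierFourier_highHighLow_ae M (-s) t f g)

theorem continuous_waveInteraction (M : ℝ) {s : ℝ} (hs : |-s| < 1) (f g : 𝓢(Plane, ℂ)) :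
    Continuous (waveInteraction M s (f.toLp 2) (g.toLp 2)) := by
  have h : waveInteraction M s (f.toLp 2) (g.toLp 2) = fun t =>
      (Lp.fourierTransformₗᵢ Plane ℂ).symm
        ((memLp_outputFourier M⁻¹ hs (𝓕 f) (𝓕 g) t).toLp (outputFourier M⁻¹ (-s) _ _ t)) := by
    funext t
    rw [waveInteraction_eq, ofFourier, dif_pos (memLp_outputFourier M⁻¹ hs (𝓕 f) (𝓕 g) t)]
    rfl
  rw [h]
  exact (Lp.fourierTransformₗᵢ Plane ℂ).symm.continuous.comp
    (continuous_toLp_outputFourier M⁻¹ hs (𝓕 f) (𝓕 g))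

theorem enorm_waveInteraction_sq (M : ℝ) {s : ℝ} (hs : |-s| < 1) (f g : 𝓢(Plane, ℂ)) (t : ℝ) :
    ‖waveInteraction M s (f.toLp 2) (g.toLp 2) t‖ₑ ^ 2 =
      ENNReal.ofReal ((2 * Real.pi) ^ (2 * -s) * (2 * Real.pi) ^ 4) *
        ∫⁻ ξ, ENNReal.ofReal (‖ξ‖ ^ (-2 * s)) *
          ‖interaction M⁻¹ (𝓕 f : 𝓢(Plane, ℂ)) (𝓕 g : 𝓢(Plane, ℂ)) t ξ‖ₑ ^ 2 := by
  have h2 : ‖(2 * (Real.pi : ℂ)) ^ 2‖ₑ ^ 2 = ENNReal.ofReal ((2 * Real.pi) ^ 4) := by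
    rw [← ofReal_norm, ← ENNReal.ofReal_pow (norm_nonneg _)]
    congr 1
    rw [norm_pow, ← pow_mul, norm_mul, Complex.norm_real, Complex.norm_ofNat,
      Real.norm_of_nonneg Real.pi_pos.le]
  rw [waveInteraction_eq, enorm_ofFourier_sq (memLp_outputFourier M⁻¹ hs (𝓕 f) (𝓕 g) t)]
  simp_rw [outputFourier]
  rw [lintegral_absPowSymbol_mul _ (measurable_const_mul_interaction M⁻¹ (𝓕 f) (𝓕 g) t),
    weightedSq, ENNReal.ofReal_mul (by positivity), mul_assoc]
  congr 1
  rw [← lintegral_const_mul' _ _ ENNReal.ofReal_ne_top]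
  refine lintegral_congr fun ξ => ?_
  rw [enorm_mul, mul_pow, h2, show 2 * -s = -2 * s by ring]
  ring

theorem weightedSq_fourier {s : ℝ} (hs : |s| < 1) (f : 𝓢(Plane, ℂ)) :
    weightedSq s (𝓕 f : 𝓢(Plane, ℂ)) = ENNReal.ofReal (((2 * Real.pi) ^ (2 * s))⁻¹) *
      ENNReal.ofReal (homSobolevNorm s (f.toLp 2)) ^ 2 := by
  rw [ofReal_homSobolevNorm_sq hs, ← mul_assoc, ← ENNReal.ofReal_mul (by positivity),
    inv_mul_cancel₀ (by positivity), ENNReal.ofReal_one, one_mul]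

theorem exists_eLpNorm_waveInteraction_le {s₁ s₂ s₃ M : ℝ} (hM : 1 < M)
    (hsum : s₁ + s₂ + s₃ = 1 / 2) (hpos : 0 < s₁ + s₂) (hs₁ : |s₁| < 1) (hs₂ : |s₂| < 1)
    (hs₃ : |-s₃| < 1) :
    ∃ C : ℝ, 0 < C ∧ ∀ f g : 𝓢(Plane, ℂ),
      eLpNorm (waveInteraction M s₃ (f.toLp 2) (g.toLp 2)) 2 (volume : Measure ℝ) ≤
        ENNReal.ofReal
          (C * homSobolevNorm s₁ (f.toLp 2) * homSobolevNorm s₂ (g.toLp 2)) := by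
  obtain ⟨C₀, hC₀, hest⟩ := exists_lintegral_interaction_le (m := M⁻¹) (by positivity)
    (inv_lt_one_of_one_lt₀ hM) hsum hpos
  -- The powers of `2π` come from the normalization of `𝓕` in the three multipliers and in the
  -- bilinear operator.
  set A : ℝ := (2 * Real.pi) ^ (2 * -s₃) * (2 * Real.pi) ^ 4 with hA
  set A₁ : ℝ := ((2 * Real.pi) ^ (2 * s₁))⁻¹ with hA₁
  set A₂ : ℝ := ((2 * Real.pi) ^ (2 * s₂))⁻¹ with hA₂
  have hA0 : 0 < A := by positivity
  have hA₁0 : 0 < A₁ := by positivity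
  have hA₂0 : 0 < A₂ := by positivity
  refine ⟨√(A * C₀ * A₁ * A₂), by positivity, fun f g => ?_⟩
  have hwt₁ := weightedSq_fourier hs₁ f
  have hwt₂ := weightedSq_fourier hs₂ g
  have hbs : weightedSq s₂ (𝓕 g : 𝓢(Plane, ℂ)) ≠ ∞ := by
    rw [hwt₂]
    exact ENNReal.mul_ne_top ENNReal.ofReal_ne_top (ENNReal.pow_ne_top ENNReal.ofReal_ne_top)
  have h := hest _ _ (𝓕 f : 𝓢(Plane, ℂ)).continuous.measurable (𝓕 g : 𝓢(Plane, ℂ)).continuous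
    (integrable_schwartz_mul_sub _ _) hbs
  rw [hwt₁, hwt₂] at h
  have hN₁ : 0 ≤ homSobolevNorm s₁ (f.toLp 2) := norm_nonneg _
  set N₁ := homSobolevNorm s₁ (f.toLp 2)
  set N₂ := homSobolevNorm s₂ (g.toLp 2)
  rw [← ENNReal.pow_le_pow_left_iff two_ne_zero, eLpNorm_two_sq]
  simp_rw [enorm_waveInteraction_sq M hs₃ f g]
  rw [lintegral_const_mul' _ _ ENNReal.ofReal_ne_top]
  refine (mul_le_mul_right h _).trans (le_of_eq ?_)
  rw [ENNReal.ofReal_mul (p := √(A * C₀ * A₁ * A₂) * N₁) (by positivity),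
    ENNReal.ofReal_mul (p := √(A * C₀ * A₁ * A₂)) (by positivity),
    mul_pow (ENNReal.ofReal _ * ENNReal.ofReal N₁), mul_pow (ENNReal.ofReal √_),
    ← ENNReal.ofReal_pow (Real.sqrt_nonneg _), Real.sq_sqrt (by positivity),
    ENNReal.ofReal_mul (p := A * C₀ * A₁) (by positivity),
    ENNReal.ofReal_mul (p := A * C₀) (by positivity), ENNReal.ofReal_mul (p := A) (by positivity)]
  ring

end

/-- The space-time norm `L²_{t,x}` is the norm of `L²(ℝ; L²(ℝ²))`. The first conjuncts say that
all the operators are applied within their domains. -/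
theorem theorem6 (s₁ s₂ s₃ M : ℝ) (hM : 1 < M)
    (hsum : s₁ + s₂ + s₃ = 1 / 2) (hs₁ : s₁ < 5 / 8) (hs₂ : s₂ < 5 / 8) (hpos : 0 < s₁ + s₂) :
    ∃ C : ℝ, 0 < C ∧ ∀ f g : 𝓢(Plane, ℂ),
      InMultiplierDomain (absPowSymbol s₁) (f.toLp 2) ∧
      InMultiplierDomain (absPowSymbol s₂) (g.toLp 2) ∧
      (∀ t : ℝ,
        InHighHighLowDomain M (propagatorPlus t (f.toLp 2)) (propagatorPlus t (g.toLp 2)) ∧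
        InMultiplierDomain (absPowSymbol (-s₃))
          (highHighLow M (propagatorPlus t (f.toLp 2)) (propagatorPlus t (g.toLp 2)))) ∧
      MemLp (waveInteraction M s₃ (f.toLp 2) (g.toLp 2)) 2 (volume : Measure ℝ) ∧
      eLpNorm (waveInteraction M s₃ (f.toLp 2) (g.toLp 2)) 2 (volume : Measure ℝ) ≤
        ENNReal.ofReal
          (C * homSobolevNorm s₁ (f.toLp 2) * homSobolevNorm s₂ (g.toLp 2)) := by
  have hp₁ : |s₁| < 1 := abs_lt.2 ⟨by linarith, by linarith⟩
  have hp₂ : |s₂| < 1 := abs_lt.2 ⟨by linarith, by linarith⟩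
  have hp₃ : |-s₃| < 1 := abs_lt.2 ⟨by linarith, by linarith⟩
  obtain ⟨C, hC, hbound⟩ := exists_eLpNorm_waveInteraction_le hM hsum hpos hp₁ hp₂ hp₃
  refine ⟨C, hC, fun f g => ⟨inMultiplierDomain_absPowSymbol hp₁ f,
    inMultiplierDomain_absPowSymbol hp₂ g, fun t => ⟨?_, ?_⟩,
    ⟨(continuous_waveInteraction M hp₃ f g).aestronglyMeasurable,
      (hbound f g).trans_lt ENNReal.ofReal_lt_top⟩, hbound f g⟩⟩
  · rw [InHighHighLowDomain, highHighLowFourier_eq]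
    exact memLp_const_mul_interaction M⁻¹ _ _ t
  · exact (memLp_outputFourier M⁻¹ hp₃ _ _ t).ae_eq
      (multiplierFourier_highHighLow_ae M (-s₃) t f g).symm
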